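/- Let $B=(B(t))_{t\ge 0}$ be a standard one-dimensional Brownian motion (drift $0$, variance $1$ per unit time, almost surely continuous paths), observed on the time window $[0,1]$. Let $W$ be the flipped path $$W(t)=B(0)+\bigl(B(t)-B(0)\bigr)\,\operatorname{sign}\bigl(B(1)-B(0)\bigr),\qquad 0\le t\le 1,$$ whose increment over $[0,1]$ is almost surely positive, and let $$C=W(1)-W(0),\qquad H=\max_{0\le t\le 1}W(t)-W(0),\qquad L=\min_{0\le t\le 1}W(t)-W(0).$$ Then $C H L^2$ is integrable and $$E[C H L^2]=\frac{\zeta(3)}{16}-2\log 2+\frac{47}{32}\approx 0.1575842,$$ where $\zeta$ is the Riemann zeta function and the decimal value is correct to the seven digits shown (error less than $5\cdot 10^{-8}$). -/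

import Mathlib

open MeasureTheory ProbabilityTheory
open scoped NNReal

namespace FlippedPath

/-- The close-minus-open `w(1) - w(0)` of a path, over the time window `[0,1]`. -/
noncomputable def spreadClose (w : ℝ≥0 → ℝ) : ℝ := w 1 - w 0

/-- The high-minus-open `max_{0 ≤ t ≤ 1} w(t) - w(0)` of a path. -/
noncomputable def spreadHigh (w : ℝ≥0 → ℝ) : ℝ := sSup (w '' Set.Icc 0 1) - w 0

/-- The low-minus-open `min_{0 ≤ t ≤ 1} w(t) - w(0)` of a path. -/
noncomputable def spreadLow (w : ℝ≥0 → ℝ) : ℝ := sInf (w '' Set.Icc 0 1) - w 0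

/-- The flipped path `W(t) = w(0) + (w(t) - w(0)) * sign (w(1) - w(0))`. -/
noncomputable def flip (w : ℝ≥0 → ℝ) : ℝ≥0 → ℝ :=
  fun t => w 0 + (w t - w 0) * Real.sign (w 1 - w 0)

/-- `C`: the close of the flipped path, relative to its starting point. -/
noncomputable def C (w : ℝ≥0 → ℝ) : ℝ := spreadClose (flip w)

/-- `H`: the high of the flipped path, relative to its starting point. -/
noncomputable def H (w : ℝ≥0 → ℝ) : ℝ := spreadHigh (flip w)

/-- `L`: the low (a nonpositive number) of the flipped path, relative to its starting point. -/
noncomputable def L (w : ℝ≥0 → ℝ) : ℝ := spreadLow (flip w)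

end FlippedPath

/-! Split by the sign of `B 1`: almost surely `C H L ^ 2` is `upProduct` of `B` plus `upProduct` of
`-B`, and `-B` is again a Brownian motion. So the mean is twice that of `B(1)⁺ · max B · (min B)²`.
The layer-cake formula (`lintegral_mul_ofReal_mul_sq`) writes this as the integral over `a, b > 0`
of `2a · E[B(1)⁺; B exceeds b and goes below -a]`.

The crossing expectation follows by inclusion-exclusion (`setIntegral_enter_inter`) from entry into
`(b, ∞)`, into `(-∞, -a)`, and into their union. In each case let `f` agree with `x⁺` outside the
set and be odd about its finite endpoints. By the reflection principle `f(B 1)` has mean zero on the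
entry event; off that event `B 1` is outside the set, so `f(B 1) = B(1)⁺`. Hence the mean of `B(1)⁺`
on entry is the difference of two Gaussian integrals. For the union, `f` is the odd periodic
extension.

Cutting its Gaussian integral into periods gives the method-of-images series (`ofReal_crossing`),
grouped so that every term is nonnegative. Tonelli then allows integration in `a, b` term by term.
In the variables `x`, `b - x`, `a` each image is `phi` of a positive linear form, so rescaling
reduces it to the integral of `x a phi(x + y + a)` over the octant, which is `1/16`. What remains is
the series of rational numbers `imageCoeff`; partial fractions split it into `ζ(3)`, an alternating
harmonic series with sum `log 2`, and telescoping terms. -/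

open Filter Topology Set
open scoped ENNReal

namespace FlippedPath

/-! ### The reflection principle, by discretising the entry time on a grid. -/

section Reflection

variable {Ω : Type*} [MeasurableSpace Ω] {P : Measure Ω} {B : ℝ≥0 → Ω → ℝ}

/-- The last increment of a Brownian motion is symmetric given finitely many past values. -/
lemma identDistrib_increment_neg (hB : IsPreBrownianReal B P) {t₀ : ℝ≥0} (h1 : t₀ ≤ 1)
    {ι : Type*} [Finite ι] (τ : ι → ℝ≥0) (hτ : ∀ i, τ i ≤ t₀) :
    IdentDistrib (fun ω ↦ (B 1 ω - B t₀ ω, fun i ↦ B (τ i) ω))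
      (fun ω ↦ (-(B 1 ω - B t₀ ω), fun i ↦ B (τ i) ω)) P P := by
  have hP : IsProbabilityMeasure P := hB.isGaussianProcess.isProbabilityMeasure
  have hind : IndepFun (fun ω ↦ B 1 ω - B t₀ ω) (fun ω i ↦ B (τ i) ω) P := by
    have m1 : Measurable (fun f : ℝ≥0 → ℝ ↦ f (1 - t₀)) := measurable_pi_apply _
    have m2 : Measurable (fun (f : Set.Iic t₀ → ℝ) (i : ι) ↦ f ⟨τ i, hτ i⟩) := by fun_prop
    convert (hB.indepFun_shift t₀).comp m1 m2 using 1
    · ext ω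
      simp [add_tsub_cancel_of_le h1]
    · rfl
  have hlaw : HasLaw (fun ω ↦ B 1 ω - B t₀ ω) (gaussianReal 0 (nndist (1 : ℝ≥0).1 t₀.1)) P :=
    hB.hasLaw_sub 1 t₀
  have hneg : IdentDistrib (fun ω ↦ B 1 ω - B t₀ ω) (fun ω ↦ -(B 1 ω - B t₀ ω)) P P := by
    refine ⟨hlaw.aemeasurable, hlaw.aemeasurable.neg, ?_⟩
    have := gaussianReal_neg hlaw
    rw [hlaw.map_eq]
    exact (neg_zero (G := ℝ) ▸ this.map_eq).symm
  have haem : AEMeasurable (fun ω i ↦ B (τ i) ω) P :=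
    aemeasurable_pi_lambda _ fun i ↦ hB.aemeasurable _
  exact hneg.prodMk (IdentDistrib.refl haem) hind
    (hind.comp (φ := fun x ↦ -x) (ψ := id) (by fun_prop) measurable_id)

/-- The path is in `U` at the grid time `k / (n + 1)`, and not at earlier grid times. -/
def FirstHit (U : Set ℝ) (w : ℝ≥0 → ℝ) (n k : ℕ) : Prop :=
  w (k / (n + 1)) ∈ U ∧ ∀ j < k, w (j / (n + 1)) ∉ U

lemma FirstHit.unique {U : Set ℝ} {w : ℝ≥0 → ℝ} {n k l : ℕ} (hk : FirstHit U w n k)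
    (hl : FirstHit U w n l) : k = l := by
  rcases lt_trichotomy k l with h | h | h
  · exact absurd hk.1 (hl.2 k h)
  · exact h
  · exact absurd hl.1 (hk.2 l h)

lemma grid_le_one {n k : ℕ} (hk : k < n + 2) : (k / (n + 1) : ℝ≥0) ≤ 1 := by
  rw [div_le_one (by positivity)]
  exact_mod_cast Nat.lt_succ_iff.mp hk

/-- A continuous path that enters an open set is in that set at a time of any fine grid. -/
lemma eventually_exists_firstHit {w : ℝ≥0 → ℝ} (hw : Continuous w) {U : Set ℝ} (hU : IsOpen U)
    {t : ℝ≥0} (ht : t ≤ 1) (htU : w t ∈ U) :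
    ∀ᶠ n : ℕ in atTop, ∃ k < n + 2, FirstHit U w n k := by
  classical
  have hgrid : Tendsto (fun n : ℕ ↦ ((⌊t * (n + 1)⌋₊ : ℝ≥0) / (n + 1))) atTop (𝓝 t) := by
    have := (tendsto_nat_floor_mul_div_atTop (R := ℝ) (a := t) t.2).comp
      (tendsto_natCast_atTop_atTop.comp (tendsto_add_atTop_nat 1))
    rw [← NNReal.tendsto_coe]
    refine this.congr fun n ↦ ?_
    simp only [Function.comp_apply, NNReal.coe_div, NNReal.coe_natCast, NNReal.coe_add,
      NNReal.coe_one, Nat.cast_add, Nat.cast_one]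
    congr 2
  have hev : ∀ᶠ n : ℕ in atTop, w ((⌊t * (n + 1)⌋₊ : ℝ≥0) / (n + 1)) ∈ U :=
    ((hw.tendsto t).comp hgrid).eventually (hU.mem_nhds htU)
  filter_upwards [hev] with n hn
  have hH : ∃ k : ℕ, w (k / (n + 1)) ∈ U := ⟨_, hn⟩
  refine ⟨Nat.find hH, ?_, Nat.find_spec hH, fun j hj ↦ Nat.find_min hH hj⟩
  refine (Nat.find_min' hH hn).trans_lt ?_
  have h1 : t * ((n : ℝ≥0) + 1) ≤ ((n + 1 : ℕ) : ℝ≥0) := by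
    push_cast
    exact mul_le_of_le_one_left zero_le ht
  have := Nat.floor_mono h1
  rw [Nat.floor_natCast] at this
  lia

/-- For continuous paths and open `U`, entry is already seen at countably many grid times. -/
lemma nullMeasurableSet_enter (hB : IsBrownianReal B P) {U : Set ℝ} (hU : IsOpen U) :
    NullMeasurableSet {ω | ∃ t ≤ (1 : ℝ≥0), B t ω ∈ U} P := by
  have hm : NullMeasurableSet (⋃ n : ℕ, ⋃ k ∈ Finset.range (n + 2),
      {ω | B (k / (n + 1)) ω ∈ U}) P :=
    NullMeasurableSet.iUnion fun n ↦ Finset.nullMeasurableSet_biUnion _ fun k _ ↦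
      (hB.aemeasurable _).nullMeasurableSet_preimage hU.measurableSet
  refine hm.congr ?_
  filter_upwards [hB.cont] with ω hc
  refine propext ⟨fun h ↦ ?_, fun ⟨t, ht, htU⟩ ↦ ?_⟩
  · obtain ⟨n, k, hk, hh⟩ : ∃ n : ℕ, ∃ k ∈ Finset.range (n + 2), B (k / (n + 1)) ω ∈ U := by
      simpa using mem_iUnion₂.1 h
    exact ⟨_, grid_le_one (Finset.mem_range.1 hk), hh⟩
  · obtain ⟨n, k, hk, hh⟩ := (eventually_exists_firstHit hc hU ht htU).exists
    exact mem_iUnion.2 ⟨n, mem_iUnion₂.2 ⟨k, Finset.mem_range.2 hk, hh.1⟩⟩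

open Classical in
lemma aemeasurable_firstHit (hB : IsPreBrownianReal B P) {U : Set ℝ} (hU : MeasurableSet U)
    (n k : ℕ) {g : Ω → ℝ} (hg : AEStronglyMeasurable g P) :
    AEStronglyMeasurable (fun ω ↦ if FirstHit U (B · ω) n k then g ω else 0) P := by
  have : NullMeasurableSet {ω | FirstHit U (B · ω) n k} P := by
    have hm : ∀ j : ℕ, NullMeasurableSet {ω | B (j / (n + 1)) ω ∈ U} P := fun j ↦
      (hB.aemeasurable _).nullMeasurableSet_preimage hU
    have : {ω | FirstHit U (B · ω) n k} = {ω | B (k / (n + 1)) ω ∈ U} ∩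
        ⋂ j ∈ Finset.range k, {ω | B (j / (n + 1)) ω ∈ U}ᶜ := by
      ext ω; simp [FirstHit]
    rw [this]
    exact (hm k).inter (Finset.nullMeasurableSet_biInter _ fun j _ ↦ (hm j).compl)
  have h2 := hg.indicator₀ this
  exact h2.congr (ae_of_all _ fun ω ↦ by simp [Set.indicator_apply])

-- The discrete form of reflection: `B 1` is the value at the hitting time plus a later increment.
-- That increment is symmetric given the past, and flipping its sign turns `B 1` into `2 * B (k / (n
-- + 1)) - B 1`.
open Classical in
lemma integral_firstHit_reflect (hB : IsPreBrownianReal B P) {U : Set ℝ} (hU : MeasurableSet U)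
    {f : ℝ → ℝ} (hf : Measurable f) {n k : ℕ} (hk : k < n + 2) :
    ∫ ω, (if FirstHit U (B · ω) n k then f (B 1 ω) else 0) ∂P =
    ∫ ω, (if FirstHit U (B · ω) n k then f (2 * B (k / (n + 1)) ω - B 1 ω) else 0) ∂P := by
  have hid := identDistrib_increment_neg hB (grid_le_one hk)
    (fun i : Fin (k + 1) ↦ ((i : ℕ) / (n + 1) : ℝ≥0))
    (fun i ↦ by gcongr; exact Nat.lt_succ_iff.mp i.2)
  let E : Set (Fin (k + 1) → ℝ) := {v | v (Fin.last k) ∈ U ∧ ∀ j : Fin k, v j.castSucc ∉ U}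
  have hE : MeasurableSet E := by
    have : E = (fun v ↦ v (Fin.last k)) ⁻¹' U ∩ ⋂ j : Fin k, ((fun v ↦ v j.castSucc) ⁻¹' U)ᶜ := by
      ext v; simp [E]
    rw [this]
    exact (hU.preimage (by fun_prop)).inter
      (MeasurableSet.iInter fun j ↦ (hU.preimage (by fun_prop)).compl)
  let F : ℝ × (Fin (k + 1) → ℝ) → ℝ := fun p ↦ if p.2 ∈ E then f (p.2 (Fin.last k) + p.1) else 0
  have hF : Measurable F :=
    Measurable.ite (hE.preimage measurable_snd) (hf.comp (by fun_prop)) measurable_const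
  have hEiff : ∀ ω, (fun i : Fin (k + 1) ↦ B ((i : ℕ) / (n + 1)) ω) ∈ E ↔
      FirstHit U (B · ω) n k := by
    intro ω
    simp only [E, FirstHit, Set.mem_ofPred_eq, Fin.val_last, Fin.val_castSucc]
    refine and_congr_right fun _ ↦ ⟨fun h j hj ↦ h ⟨j, hj⟩, fun h j ↦ h j j.2⟩
  have h := (hid.comp hF).integral_eq
  simp only [Function.comp_def, F, hEiff, Fin.val_last] at h
  convert h using 4
  · congr 1; ring
  · congr 1; ring

/-- **Reflection principle.** If `f` is odd about each point of `S`, and a path can only enter `U`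
through `S`, then `f (B 1)` has mean zero on the event that `B` enters `U` before time `1`. -/
theorem integral_indicator_enter_eq_zero (hB : IsBrownianReal B P) {f : ℝ → ℝ}
    (hf : UniformContinuous f) {K : ℝ} (hK : ∀ x, |f x| ≤ K) {U S : Set ℝ} (hU : IsOpen U)
    (h0 : (0 : ℝ) ∉ U) (hS : ∀ s ∈ S, ∀ x, f (2 * s - x) = -f x)
    (hUS : ∀ x ∉ U, ∀ y ∈ U, ∃ s ∈ S, |y - s| ≤ |y - x|) :
    ∫ ω, {ω | ∃ t ≤ (1 : ℝ≥0), B t ω ∈ U}.indicator (fun ω ↦ f (B 1 ω)) ω ∂P = 0 := by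
  classical
  have hP : IsProbabilityMeasure P := hB.isGaussianProcess.isProbabilityMeasure
  have hmB : ∀ t, AEMeasurable (B t) P := hB.aemeasurable
  have hfm : Measurable f := hf.continuous.measurable
  have hm1 : AEStronglyMeasurable (fun ω ↦ f (B 1 ω)) P :=
    (hfm.comp_aemeasurable (hmB 1)).aestronglyMeasurable
  have hm2 : ∀ t, AEStronglyMeasurable (fun ω ↦ f (2 * B t ω - B 1 ω)) P := fun t ↦
    (hfm.comp_aemeasurable (((hmB t).const_mul 2).sub (hmB 1))).aestronglyMeasurable
  have hK0 : 0 ≤ K := (abs_nonneg _).trans (hK 0)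
  -- At most one summand is nonzero. `X n` tends to the integrand of the claim; `Y n` adds the
  -- reflected copy, so its mean is `2 E[X n]`. It remains to see that `Y n` tends to zero.
  let X : ℕ → Ω → ℝ := fun n ω ↦ ∑ k ∈ Finset.range (n + 2),
    if FirstHit U (B · ω) n k then f (B 1 ω) else 0
  let Y : ℕ → Ω → ℝ := fun n ω ↦ ∑ k ∈ Finset.range (n + 2),
    if FirstHit U (B · ω) n k then f (B 1 ω) + f (2 * B (k / (n + 1)) ω - B 1 ω) else 0
  have hsum : ∀ (n : ℕ) (ω : Ω) (g : ℕ → ℝ),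
      (∃ k < n + 2, FirstHit U (B · ω) n k ∧
        ∑ k ∈ Finset.range (n + 2), (if FirstHit U (B · ω) n k then g k else 0) = g k) ∨
      ((∀ k < n + 2, ¬ FirstHit U (B · ω) n k) ∧
        ∑ k ∈ Finset.range (n + 2), (if FirstHit U (B · ω) n k then g k else 0) = 0) := by
    intro n ω g
    by_cases h : ∃ k < n + 2, FirstHit U (B · ω) n k
    · obtain ⟨k, hk, hh⟩ := h
      refine Or.inl ⟨k, hk, hh, ?_⟩
      rw [Finset.sum_eq_single k, if_pos hh]
      · intro l _ hl
        exact if_neg fun h' ↦ hl (h'.unique hh)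
      · intro h'; exact absurd (Finset.mem_range.2 hk) h'
    · push Not at h
      exact Or.inr ⟨h, Finset.sum_eq_zero fun k hk ↦ if_neg (h k (Finset.mem_range.1 hk))⟩
  have hint1 : ∀ n k, Integrable (fun ω ↦ if FirstHit U (B · ω) n k then f (B 1 ω) else 0) P :=
    fun n k ↦ Integrable.of_bound (aemeasurable_firstHit hB.toIsPreBrownianReal hU.measurableSet
      n k hm1) K (ae_of_all _ fun ω ↦ by split_ifs <;> simp [hK, hK0])
  have hint2 : ∀ n k, Integrable (fun ω ↦ if FirstHit U (B · ω) n k then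
      f (2 * B (k / (n + 1)) ω - B 1 ω) else 0) P :=
    fun n k ↦ Integrable.of_bound (aemeasurable_firstHit hB.toIsPreBrownianReal hU.measurableSet
      n k (hm2 _)) K (ae_of_all _ fun ω ↦ by split_ifs <;> simp [hK, hK0])
  have hXY : ∀ n, ∫ ω, Y n ω ∂P = 2 * ∫ ω, X n ω ∂P := by
    intro n
    have hYX : ∀ ω, Y n ω = X n ω + ∑ k ∈ Finset.range (n + 2),
        if FirstHit U (B · ω) n k then f (2 * B (k / (n + 1)) ω - B 1 ω) else 0 := by
      intro ω
      simp only [X, Y, ← Finset.sum_add_distrib]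
      refine Finset.sum_congr rfl fun k _ ↦ ?_
      split_ifs <;> simp
    simp_rw [hYX]
    rw [integral_add (integrable_finsetSum _ fun k _ ↦ hint1 n k)
      (integrable_finsetSum _ fun k _ ↦ hint2 n k), integral_finsetSum _ fun k _ ↦ hint2 n k]
    rw [two_mul]
    congr 1
    rw [integral_finsetSum _ fun k _ ↦ hint1 n k]
    exact Finset.sum_congr rfl fun k hk ↦ (integral_firstHit_reflect hB.toIsPreBrownianReal
      hU.measurableSet hfm (Finset.mem_range.1 hk)).symm
  have hYm : ∀ n, AEStronglyMeasurable (Y n) P := fun n ↦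
    Finset.aestronglyMeasurable_fun_sum _ fun k _ ↦ aemeasurable_firstHit hB.toIsPreBrownianReal
      hU.measurableSet n k (hm1.add (hm2 _))
  have hXm : ∀ n, AEStronglyMeasurable (X n) P := fun n ↦
    Finset.aestronglyMeasurable_fun_sum _ fun k _ ↦ aemeasurable_firstHit hB.toIsPreBrownianReal
      hU.measurableSet n k hm1
  have hY0 : Tendsto (fun n ↦ ∫ ω, Y n ω ∂P) atTop (𝓝 (∫ _, (0 : ℝ) ∂P)) := by
    refine tendsto_integral_of_dominated_convergence (fun _ ↦ 2 * K) hYm (integrable_const _)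
      (fun n ↦ ae_of_all _ fun ω ↦ ?_) ?_
    · rcases hsum n ω (fun k ↦ f (B 1 ω) + f (2 * B (k / (n + 1)) ω - B 1 ω)) with
        ⟨k, -, -, h⟩ | ⟨-, h⟩
      · simp only [Y, h, Real.norm_eq_abs]
        refine (abs_add_le _ _).trans ?_
        linarith [hK (B 1 ω), hK (2 * B (k / (n + 1)) ω - B 1 ω)]
      · simp only [Y, h, norm_zero]; positivity
    · filter_upwards [hB.cont, hB.eval_zero_ae_eq_zero] with ω hc hz
      rw [Metric.tendsto_atTop]
      intro ε hε
      obtain ⟨δ, hδ, hfδ⟩ := Metric.uniformContinuous_iff.1 hf ε hε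
      have huc : UniformContinuousOn (B · ω) (Icc 0 1) :=
        isCompact_Icc.uniformContinuousOn_of_continuous hc.continuousOn
      obtain ⟨η, hη, hBη⟩ := Metric.uniformContinuousOn_iff.1 huc (δ / 2) (by positivity)
      obtain ⟨N, hN⟩ := exists_nat_one_div_lt hη
      refine ⟨N, fun n hn ↦ ?_⟩
      rcases hsum n ω (fun k ↦ f (B 1 ω) + f (2 * B (k / (n + 1)) ω - B 1 ω)) with
        ⟨k, hkn, hk, h⟩ | ⟨-, h⟩
      · simp only [Y, h]
        -- The path starts at `0 ∉ U`, so the first hit has a predecessor on the grid, which lies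
        -- outside `U`; `hUS` then gives a centre of oddness within one grid increment of the hit.
        obtain ⟨j, rfl⟩ : ∃ j, k = j + 1 := by
          refine Nat.exists_eq_succ_of_ne_zero ?_
          rintro rfl
          apply h0
          simpa [hz] using hk.1
        obtain ⟨s, hs, hle⟩ := hUS _ (hk.2 j (Nat.lt_succ_self j)) _ hk.1
        have hdist : |B ((j + 1 : ℕ) / (n + 1)) ω - B (j / (n + 1)) ω| < δ / 2 := by
          refine hBη _ ⟨zero_le, grid_le_one hkn⟩ _
            ⟨zero_le, grid_le_one ((Nat.lt_succ_self j).trans hkn)⟩ ?_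
          rw [NNReal.dist_eq]
          push_cast
          rw [← sub_div, add_sub_cancel_left, abs_of_pos (by positivity)]
          refine lt_of_le_of_lt ?_ hN
          gcongr
        -- Oddness about `s` makes `Y n` a difference of values of `f` at two points `2 |B - s|`
        -- apart, with `B` the path at the hit; this is why the modulus above was taken for `δ / 2`.
        have hodd := hS s hs (2 * B ((j + 1 : ℕ) / (n + 1)) ω - B 1 ω)
        rw [show f (2 * B ((j + 1 : ℕ) / (n + 1)) ω - B 1 ω) = -f (2 * s -
          (2 * B ((j + 1 : ℕ) / (n + 1)) ω - B 1 ω)) by linarith]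
        rw [← sub_eq_add_neg, Real.dist_eq, sub_zero, ← Real.dist_eq]
        apply hfδ
        rw [Real.dist_eq, show B 1 ω - (2 * s - (2 * B ((j + 1 : ℕ) / (n + 1)) ω - B 1 ω)) =
          2 * (B ((j + 1 : ℕ) / (n + 1)) ω - s) by ring, abs_mul, abs_two]
        linarith
      · simpa only [Y, h, dist_self] using hε
  have hXlim : Tendsto (fun n ↦ ∫ ω, X n ω ∂P) atTop
      (𝓝 (∫ ω, {ω | ∃ t ≤ (1 : ℝ≥0), B t ω ∈ U}.indicator (fun ω ↦ f (B 1 ω)) ω ∂P)) := by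
    refine tendsto_integral_of_dominated_convergence (fun _ ↦ K) hXm (integrable_const _)
      (fun n ↦ ae_of_all _ fun ω ↦ ?_) ?_
    · rcases hsum n ω (fun k ↦ f (B 1 ω)) with ⟨k, -, -, h⟩ | ⟨-, h⟩
      · simpa only [X, h, Real.norm_eq_abs] using hK _
      · simpa only [X, h, norm_zero] using hK0
    · filter_upwards [hB.cont] with ω hc
      by_cases hex : ∃ t ≤ (1 : ℝ≥0), B t ω ∈ U
      · rw [Set.indicator_of_mem (by exact hex)]
        obtain ⟨t, ht, htU⟩ := hex
        refine tendsto_const_nhds.congr' ?_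
        filter_upwards [eventually_exists_firstHit hc hU ht htU] with n ⟨k, hk, hkH⟩
        rcases hsum n ω (fun k ↦ f (B 1 ω)) with ⟨k, -, -, h⟩ | ⟨hno, -⟩
        · exact h.symm
        · exact absurd hkH (hno k hk)
      · rw [Set.indicator_of_notMem (by exact hex)]
        refine tendsto_const_nhds.congr fun n ↦ ?_
        rcases hsum n ω (fun k ↦ f (B 1 ω)) with ⟨k, hk, hh, -⟩ | ⟨-, h⟩
        · exact absurd ⟨_, grid_le_one hk, hh.1⟩ hex
        · exact h.symm
  have h2 := hXlim.const_mul 2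
  simp_rw [← hXY] at h2
  rw [integral_zero] at hY0
  have := tendsto_nhds_unique h2 hY0
  linarith

/-- The reflection principle for pointwise limits of uniformly continuous functions. -/
theorem integral_indicator_enter_eq_zero_of_tendsto (hB : IsBrownianReal B P) {f : ℝ → ℝ}
    {F : ℕ → ℝ → ℝ} {G : ℝ → ℝ} (hF : ∀ n, UniformContinuous (F n)) {K : ℕ → ℝ}
    (hK : ∀ n x, |F n x| ≤ K n) (hG : ∀ n x, |F n x| ≤ G x)
    (hGi : Integrable (fun ω ↦ G (B 1 ω)) P)
    (hlim : ∀ x, Tendsto (F · x) atTop (𝓝 (f x)))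
    {U S : Set ℝ} (hU : IsOpen U)
    (h0 : (0 : ℝ) ∉ U) (hS : ∀ n, ∀ s ∈ S, ∀ x, F n (2 * s - x) = -F n x)
    (hUS : ∀ x ∉ U, ∀ y ∈ U, ∃ s ∈ S, |y - s| ≤ |y - x|) :
    ∫ ω in {ω | ∃ t ≤ (1 : ℝ≥0), B t ω ∈ U}, f (B 1 ω) ∂P = 0 := by
  have hm := nullMeasurableSet_enter hB hU
  have hz : ∀ n, ∫ ω in {ω | ∃ t ≤ (1 : ℝ≥0), B t ω ∈ U}, F n (B 1 ω) ∂P = 0 := fun n ↦ by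
    rw [← integral_indicator₀ hm]
    exact integral_indicator_enter_eq_zero hB (hF n) (hK n) hU h0 (hS n) hUS
  have ht : Tendsto (fun n ↦ ∫ ω in {ω | ∃ t ≤ (1 : ℝ≥0), B t ω ∈ U}, F n (B 1 ω) ∂P) atTop
      (𝓝 (∫ ω in {ω | ∃ t ≤ (1 : ℝ≥0), B t ω ∈ U}, f (B 1 ω) ∂P)) :=
    tendsto_integral_of_dominated_convergence (fun ω ↦ G (B 1 ω))
      (fun n ↦ (((hF n).continuous.measurable.comp_aemeasurable
        (hB.aemeasurable 1)).aestronglyMeasurable).restrict)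
      hGi.restrict (fun n ↦ ae_of_all _ fun ω ↦ hG n _) (ae_of_all _ fun ω ↦ hlim _)
  simp_rw [hz] at ht
  exact (tendsto_nhds_unique tendsto_const_nhds ht).symm

end Reflection

/-! ### Odd extensions of the positive part about one or two barriers. -/

section OddExtensions

/-- A Lipschitz odd approximation of the sign function. -/
noncomputable def approxSign (n : ℕ) (s : ℝ) : ℝ := max (-1) (min 1 (n * s))

lemma continuous_approxSign (n : ℕ) : Continuous (approxSign n) := by
  unfold approxSign; fun_prop

lemma approxSign_neg (n : ℕ) (s : ℝ) : approxSign n (-s) = -approxSign n s := by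
  simp only [approxSign, max_def, min_def]
  split_ifs <;> linarith

lemma abs_approxSign_le (n : ℕ) (s : ℝ) : |approxSign n s| ≤ 1 :=
  abs_le.2 ⟨le_max_left _ _, max_le (by norm_num) (min_le_left _ _)⟩

lemma tendsto_approxSign (s : ℝ) :
    Tendsto (fun n ↦ approxSign n s) atTop (𝓝 (Real.sign s)) := by
  rcases lt_trichotomy s 0 with h | rfl | h
  · rw [Real.sign_of_neg h]
    refine tendsto_const_nhds.congr' ?_
    filter_upwards [eventually_ge_atTop ⌈1 / -s⌉₊] with n hn
    have : 1 / -s ≤ n := Nat.ceil_le.1 hn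
    rw [div_le_iff₀ (by linarith)] at this
    rw [approxSign, max_eq_left]
    exact (min_le_right _ _).trans (by linarith)
  · simp [approxSign, Real.sign_zero]
  · rw [Real.sign_of_pos h]
    refine tendsto_const_nhds.congr' ?_
    filter_upwards [eventually_ge_atTop ⌈1 / s⌉₊] with n hn
    have : 1 / s ≤ n := Nat.ceil_le.1 hn
    rw [div_le_iff₀ h] at this
    rw [approxSign, min_eq_left this, max_eq_right (by norm_num)]

/-- The angle `π (x + a) / (a + b)`, which runs over `[0, π]` as `x` runs over `[-a, b]`. -/
noncomputable def angle (a b x : ℝ) : ℝ := Real.pi * (x + a) / (a + b)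

/-- The line folded onto `[-a, b]`. -/
noncomputable def fold (a b x : ℝ) : ℝ :=
  (a + b) / Real.pi * Real.arccos (Real.cos (angle a b x)) - a

/-- The extension of `x ↦ max x 0` from `(-a, b)` to the line that is odd about `-a` and `b`. -/
noncomputable def oddPeriodic (a b x : ℝ) : ℝ :=
  Real.sign (Real.sin (angle a b x)) * max (fold a b x) 0

/-- The extension of `x ↦ max x 0` from `x < b` to the line that is odd about `b`. -/
noncomputable def oddAbout (b x : ℝ) : ℝ := Real.sign (b - x) * max (b - |x - b|) 0

variable {a b : ℝ}

lemma angle_reflect_right (hw : 0 < a + b) (x : ℝ) :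
    angle a b (2 * b - x) = 2 * Real.pi - angle a b x := by
  unfold angle; field_simp; ring

lemma angle_reflect_left (x : ℝ) : angle a b (2 * -a - x) = -angle a b x := by
  unfold angle; ring

lemma angle_add_period (hw : 0 < a + b) (k : ℤ) (x : ℝ) :
    angle a b (x + k • (2 * (a + b))) = angle a b x + k * (2 * Real.pi) := by
  unfold angle; rw [zsmul_eq_mul]; field_simp; ring

lemma fold_reflect {s : ℝ} (hw : 0 < a + b) (hs : s = b ∨ s = -a) (x : ℝ) :
    fold a b (2 * s - x) = fold a b x := by
  unfold fold
  rcases hs with rfl | rfl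
  · rw [angle_reflect_right hw, Real.cos_two_pi_sub]
  · rw [angle_reflect_left, Real.cos_neg]

lemma sin_angle_reflect {s : ℝ} (hw : 0 < a + b) (hs : s = b ∨ s = -a) (x : ℝ) :
    Real.sin (angle a b (2 * s - x)) = -Real.sin (angle a b x) := by
  rcases hs with rfl | rfl
  · rw [angle_reflect_right hw, Real.sin_two_pi_sub]
  · rw [angle_reflect_left, Real.sin_neg]

lemma oddPeriodic_reflect {s : ℝ} (hw : 0 < a + b) (hs : s = b ∨ s = -a) (x : ℝ) :
    oddPeriodic a b (2 * s - x) = -oddPeriodic a b x := by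
  rw [oddPeriodic, oddPeriodic, sin_angle_reflect hw hs, fold_reflect hw hs, Real.sign_neg,
    neg_mul]

lemma oddPeriodic_add_period (hw : 0 < a + b) (k : ℤ) (x : ℝ) :
    oddPeriodic a b (x + k • (2 * (a + b))) = oddPeriodic a b x := by
  simp only [oddPeriodic, fold, angle_add_period hw, Real.sin_add_int_mul_two_pi,
    Real.cos_add_int_mul_two_pi]

lemma oddPeriodic_of_mem (hw : 0 < a + b) {x : ℝ} (hx : x ∈ Ioo (-a) b) :
    oddPeriodic a b x = max x 0 := by
  have hpos : 0 < angle a b x := by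
    unfold angle; have := hx.1; have := Real.pi_pos
    have : 0 < x + a := by linarith
    positivity
  have hlt : angle a b x < Real.pi := by
    unfold angle; rw [div_lt_iff₀ hw]
    exact mul_lt_mul_of_pos_left (by linarith [hx.2]) Real.pi_pos
  rw [oddPeriodic, Real.sign_of_pos (Real.sin_pos_of_pos_of_lt_pi hpos hlt), one_mul, fold,
    Real.arccos_cos hpos.le hlt.le]
  congr 1
  have := Real.pi_ne_zero
  unfold angle; field_simp; ring

lemma continuous_angle : Continuous (angle a b) := by unfold angle; fun_prop

lemma continuous_fold : Continuous (fold a b) := by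
  have := continuous_angle (a := a) (b := b)
  unfold fold; fun_prop

lemma fold_le (hw : 0 < a + b) (x : ℝ) : fold a b x ≤ b := by
  have h := Real.arccos_le_pi (Real.cos (angle a b x))
  have : (a + b) / Real.pi * Real.arccos (Real.cos (angle a b x)) ≤ (a + b) / Real.pi * Real.pi :=
    mul_le_mul_of_nonneg_left h (by positivity)
  rw [div_mul_cancel₀ _ Real.pi_ne_zero] at this
  unfold fold; linarith

lemma measurable_sign : Measurable Real.sign := by
  unfold Real.sign
  exact Measurable.ite measurableSet_Iio measurable_const
    (Measurable.ite measurableSet_Ioi measurable_const measurable_const)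

lemma abs_sign_le (x : ℝ) : |Real.sign x| ≤ 1 := by
  rcases Real.sign_apply_eq x with h | h | h <;> simp [h]

lemma measurable_oddPeriodic : Measurable (oddPeriodic a b) :=
  (measurable_sign.comp (Real.continuous_sin.comp continuous_angle).measurable).mul
    (continuous_fold.measurable.max measurable_const)

lemma measurable_oddAbout : Measurable (oddAbout b) := by
  unfold oddAbout
  exact (measurable_sign.comp (by fun_prop)).mul (by fun_prop)

lemma abs_mul_max_le {u v c : ℝ} (hu : |u| ≤ 1) (hv : v ≤ c) (hc : 0 ≤ c) :
    |u * max v 0| ≤ c := by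
  rw [abs_mul, abs_of_nonneg (le_max_right v 0)]
  exact (mul_le_of_le_one_left (le_max_right _ _) hu).trans (max_le hv hc)

lemma abs_oddPeriodic_le (ha : 0 < a) (hb : 0 < b) (x : ℝ) : |oddPeriodic a b x| ≤ b :=
  abs_mul_max_le (abs_sign_le _) (fold_le (by linarith) x) hb.le

lemma abs_oddAbout_le (hb : 0 < b) (x : ℝ) : |oddAbout b x| ≤ b :=
  abs_mul_max_le (abs_sign_le _) (by linarith [abs_nonneg (x - b)]) hb.le

lemma oddAbout_of_lt {x : ℝ} (hx : x < b) : oddAbout b x = max x 0 := by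
  rw [oddAbout, Real.sign_of_pos (by linarith), abs_of_neg (by linarith)]
  simp

lemma oddAbout_of_gt {x : ℝ} (hx : b < x) : oddAbout b x = -max (2 * b - x) 0 := by
  rw [oddAbout, Real.sign_of_neg (by linarith), abs_of_pos (by linarith)]
  ring_nf

lemma uniformContinuous_of_periodic {f : ℝ → ℝ} (hf : Continuous f) {p : ℝ} (hp : 0 < p)
    (hper : Function.Periodic f p) : UniformContinuous f := by
  have : Fact (0 < p) := ⟨hp⟩
  have h1 : UniformContinuous hper.lift :=
    CompactSpace.uniformContinuous_of_continuous (continuous_coinduced_dom.2 hf)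
  exact h1.comp (uniformContinuous_addMonoidHom_of_continuous
    (f := QuotientAddGroup.mk' (AddSubgroup.zmultiples p)) continuous_quotient_mk')

end OddExtensions

/-! ### Means of the positive part of `B 1` on crossing events. -/

section JointCrossing

variable {Ω : Type*} [MeasurableSpace Ω] {P : Measure Ω} {B : ℝ≥0 → Ω → ℝ} {a b : ℝ}

lemma integrable_abs_gaussian : Integrable (fun x : ℝ ↦ |x|) (gaussianReal 0 1) :=
  ((memLp_id_gaussianReal 1).integrable le_rfl).abs

/-- On the entry event `f` contributes nothing, so `g` may be replaced by `g - f`; off the event `B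
1 ∉ U`, where `g - f` vanishes. The restriction to the event can therefore be dropped. -/
lemma setIntegral_enter_eq_sub (hB : IsBrownianReal B P) {U : Set ℝ} (hU : IsOpen U)
    {f g : ℝ → ℝ} (hf : Integrable f (gaussianReal 0 1)) (hg : Integrable g (gaussianReal 0 1))
    (h0 : ∫ ω in {ω | ∃ t ≤ (1 : ℝ≥0), B t ω ∈ U}, f (B 1 ω) ∂P = 0)
    (hfg : ∀ᵐ x ∂(gaussianReal 0 1), x ∉ U → f x = g x) :
    ∫ ω in {ω | ∃ t ≤ (1 : ℝ≥0), B t ω ∈ U}, g (B 1 ω) ∂P =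
      ∫ x, g x ∂(gaussianReal 0 1) - ∫ x, f x ∂(gaussianReal 0 1) := by
  have hlaw : HasLaw (B 1) (gaussianReal 0 1) P := hB.hasLaw_eval 1
  have hint : ∀ {h : ℝ → ℝ}, Integrable h (gaussianReal 0 1) → Integrable (fun ω ↦ h (B 1 ω)) P :=
    fun {h} hh ↦ by
      rw [← hlaw.map_eq] at hh
      exact hh.comp_aemeasurable hlaw.aemeasurable
  rw [← hlaw.map_eq] at hfg
  have hfg' := ae_of_ae_map hlaw.aemeasurable hfg
  have hcomp : ∫ ω, (g (B 1 ω) - f (B 1 ω)) ∂P = ∫ x, (g x - f x) ∂(gaussianReal 0 1) :=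
    hlaw.integral_comp (hg.sub hf).aestronglyMeasurable
  rw [← integral_sub hg hf, ← hcomp, ← sub_zero (∫ ω in _, g (B 1 ω) ∂P), ← h0,
    ← integral_sub (hint hg).restrict (hint hf).restrict,
    ← integral_indicator₀ (nullMeasurableSet_enter hB hU)]
  refine integral_congr_ae ?_
  filter_upwards [hfg'] with ω hω
  by_cases h : ∃ t ≤ (1 : ℝ≥0), B t ω ∈ U
  · rw [indicator_of_mem (by exact h)]
  · rw [indicator_of_notMem (by exact h)]
    have : f (B 1 ω) = g (B 1 ω) := hω fun h1 ↦ h ⟨1, le_rfl, h1⟩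
    simp [this]

lemma integrable_max_gaussian : Integrable (fun x : ℝ ↦ max x 0) (gaussianReal 0 1) :=
  integrable_abs_gaussian.mono' (by fun_prop) (ae_of_all _ fun x ↦ by
    rw [Real.norm_eq_abs, abs_of_nonneg (le_max_right _ _)]
    exact max_le (le_abs_self x) (abs_nonneg x))

lemma integrable_max_gaussian_reflect :
    Integrable (fun x : ℝ ↦ max (-2 * a - x) 0) (gaussianReal 0 1) :=
  ((integrable_const |2 * a|).add integrable_abs_gaussian).mono' (by fun_prop)
    (ae_of_all _ fun x ↦ by
      rw [Real.norm_eq_abs, abs_of_nonneg (le_max_right _ _)]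
      refine max_le ?_ (by simp only [Pi.add_apply]; positivity)
      simp only [Pi.add_apply]
      linarith [neg_abs_le (2 * a), neg_abs_le x])

lemma ae_gaussian_ne (c : ℝ) : ∀ᵐ x ∂(gaussianReal 0 1), x ≠ c := by
  have := nullSingletonClass_gaussianReal (μ := 0) (v := 1) one_ne_zero
  exact compl_mem_ae_iff.2 (measure_singleton c)

lemma integrable_oddAbout (hb : 0 < b) : Integrable (oddAbout b) (gaussianReal 0 1) :=
  Integrable.of_bound measurable_oddAbout.aestronglyMeasurable b
    (ae_of_all _ fun x ↦ abs_oddAbout_le hb x)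

lemma integrable_oddPeriodic (ha : 0 < a) (hb : 0 < b) :
    Integrable (oddPeriodic a b) (gaussianReal 0 1) :=
  Integrable.of_bound measurable_oddPeriodic.aestronglyMeasurable b
    (ae_of_all _ fun x ↦ abs_oddPeriodic_le ha hb x)

lemma setIntegral_enter_Ioi (hB : IsBrownianReal B P) (hb : 0 < b) :
    ∫ ω in {ω | ∃ t ≤ (1 : ℝ≥0), B t ω ∈ Ioi b}, max (B 1 ω) 0 ∂P =
      ∫ x, max x 0 ∂(gaussianReal 0 1) - ∫ x, oddAbout b x ∂(gaussianReal 0 1) := by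
  have hP : IsProbabilityMeasure P := hB.isGaussianProcess.isProbabilityMeasure
  refine setIntegral_enter_eq_sub hB isOpen_Ioi (integrable_oddAbout hb) integrable_max_gaussian
    ?_ ?_
  · refine integral_indicator_enter_eq_zero_of_tendsto hB
      (F := fun n x ↦ approxSign n (b - x) * max (b - |x - b|) 0) (K := fun _ ↦ b)
      (G := fun _ ↦ b) (S := {b}) (fun n ↦ ?_) (fun n x ↦ ?_) (fun n x ↦ ?_) (integrable_const _)
      (fun x ↦ ?_) isOpen_Ioi (by simpa using hb.le) (fun n s hs x ↦ ?_) (fun x hx y hy ↦ ?_)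
    · refine HasCompactSupport.uniformContinuous_of_continuous ?_ ?_
      · refine HasCompactSupport.intro (isCompact_Icc (a := 0) (b := 2 * b)) fun x hx ↦ ?_
        have : b - |x - b| ≤ 0 := by
          rw [mem_Icc, not_and_or, not_le, not_le] at hx
          rcases hx with h | h
          · linarith [neg_le_abs (x - b)]
          · linarith [le_abs_self (x - b)]
        rw [max_eq_right this, mul_zero]
      · exact ((continuous_approxSign n).comp (by fun_prop)).mul (by fun_prop)
    · exact abs_mul_max_le (abs_approxSign_le _ _) (by linarith [abs_nonneg (x - b)]) hb.le
    · exact abs_mul_max_le (abs_approxSign_le _ _) (by linarith [abs_nonneg (x - b)]) hb.le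
    · exact (tendsto_approxSign _).mul_const _
    · rw [mem_singleton_iff] at hs
      subst hs
      rw [show s - (2 * s - x) = -(s - x) by ring, approxSign_neg,
        show 2 * s - x - s = -(x - s) by ring, abs_neg, neg_mul]
    · refine ⟨b, rfl, ?_⟩
      rw [mem_Ioi] at hx hy
      rw [abs_of_pos (by linarith), abs_of_pos (by linarith)]
      linarith
  · filter_upwards [ae_gaussian_ne b] with x hx hxb
    exact oddAbout_of_lt (lt_of_le_of_ne (not_lt.1 hxb) hx)

lemma setIntegral_enter_Iio (hB : IsBrownianReal B P) (ha : 0 < a) :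
    ∫ ω in {ω | ∃ t ≤ (1 : ℝ≥0), B t ω ∈ Iio (-a)}, max (B 1 ω) 0 ∂P =
      ∫ x, max (-2 * a - x) 0 ∂(gaussianReal 0 1) := by
  -- The extension odd about `-a` is `x⁺ - (-2a - x)⁺`. It is unbounded, so both parts are truncated
  -- at `n`, which preserves the oddness.
  have hi := integrable_max_gaussian.sub (integrable_max_gaussian_reflect (a := a))
  rw [setIntegral_enter_eq_sub hB isOpen_Iio hi integrable_max_gaussian ?_ ?_]
  · simp only [Pi.sub_apply]
    rw [integral_sub integrable_max_gaussian integrable_max_gaussian_reflect]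
    ring
  · refine integral_indicator_enter_eq_zero_of_tendsto hB
      (F := fun n x ↦ min (max x 0) n - min (max (-2 * a - x) 0) n) (K := fun n ↦ n)
      (G := fun x ↦ max x 0 + max (-2 * a - x) 0) (S := {-a})
      (fun n ↦ ?_) (fun n x ↦ ?_) (fun n x ↦ ?_) ?_
      (fun x ↦ ?_) isOpen_Iio (by simpa using ha.le) (fun n s hs x ↦ ?_) (fun x hx y hy ↦ ?_)
    · have h1 : UniformContinuous (fun x : ℝ ↦ min (max x 0) n) :=
        ((LipschitzWith.id.max_const 0).min_const (n : ℝ)).uniformContinuous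
      exact h1.sub (h1.comp (uniformContinuous_const.sub uniformContinuous_id))
    · have hn : (0 : ℝ) ≤ n := n.cast_nonneg
      rw [abs_le]
      constructor
      · linarith [min_le_right (max (-2 * a - x) 0) (n : ℝ), le_min (le_max_right x 0) hn]
      · linarith [min_le_right (max x 0) (n : ℝ), le_min (le_max_right (-2 * a - x) 0) hn]
    · have hn : (0 : ℝ) ≤ n := n.cast_nonneg
      rw [abs_le]
      constructor
      · linarith [min_le_left (max (-2 * a - x) 0) (n : ℝ), le_min (le_max_right x 0) hn,
          le_max_right x 0]
      · linarith [min_le_left (max x 0) (n : ℝ), le_min (le_max_right (-2 * a - x) 0) hn,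
          le_max_right (-2 * a - x) 0]
    · have hlaw : HasLaw (B 1) (gaussianReal 0 1) P := hB.hasLaw_eval 1
      have hh := integrable_max_gaussian.add (integrable_max_gaussian_reflect (a := a))
      rw [← hlaw.map_eq] at hh
      exact hh.comp_aemeasurable hlaw.aemeasurable
    · have : ∀ y : ℝ, Tendsto (fun n : ℕ ↦ min y (n : ℝ)) atTop (𝓝 y) := fun y ↦ by
        refine tendsto_const_nhds.congr' ?_
        filter_upwards [eventually_ge_atTop ⌈y⌉₊] with n hn
        rw [min_eq_left (Nat.ceil_le.1 hn)]
      exact (this _).sub (this _)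
    · rw [mem_singleton_iff] at hs
      subst hs
      rw [show -2 * a - (2 * -a - x) = x by ring, show 2 * -a - x = -2 * a - x by ring]
      ring
    · refine ⟨-a, rfl, ?_⟩
      rw [mem_Iio] at hx hy
      rw [abs_of_neg (by linarith), abs_of_neg (by linarith)]
      linarith
  · refine ae_of_all _ fun x hx ↦ ?_
    rw [mem_Iio, not_lt] at hx
    simp only [Pi.sub_apply]
    rw [max_eq_right (a := -2 * a - x) (by linarith), sub_zero]

lemma setIntegral_enter_union (hB : IsBrownianReal B P) (ha : 0 < a) (hb : 0 < b) :
    ∫ ω in {ω | ∃ t ≤ (1 : ℝ≥0), B t ω ∈ Ioi b ∪ Iio (-a)}, max (B 1 ω) 0 ∂P =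
      ∫ x, max x 0 ∂(gaussianReal 0 1) - ∫ x, oddPeriodic a b x ∂(gaussianReal 0 1) := by
  have hP : IsProbabilityMeasure P := hB.isGaussianProcess.isProbabilityMeasure
  have hw : 0 < a + b := by positivity
  have hU : IsOpen (Ioi b ∪ Iio (-a)) := isOpen_Ioi.union isOpen_Iio
  refine setIntegral_enter_eq_sub hB hU (integrable_oddPeriodic ha hb) integrable_max_gaussian
    ?_ ?_
  · refine integral_indicator_enter_eq_zero_of_tendsto hB
      (F := fun n x ↦ approxSign n (Real.sin (angle a b x)) * max (fold a b x) 0) (K := fun _ ↦ b)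
      (G := fun _ ↦ b) (S := {b, -a}) (fun n ↦ ?_) (fun n x ↦ ?_) (fun n x ↦ ?_)
      (integrable_const _) (fun x ↦ ?_) hU (by simp [hb.le, ha.le]) (fun n s hs x ↦ ?_)
      (fun x hx y hy ↦ ?_)
    · refine uniformContinuous_of_periodic (p := 2 * (a + b)) ?_ (by positivity) fun x ↦ ?_
      · exact ((continuous_approxSign n).comp (Real.continuous_sin.comp continuous_angle)).mul
          (continuous_fold.max continuous_const)
      · have := angle_add_period hw 1 x
        rw [one_zsmul, Int.cast_one, one_mul] at this
        simp only [fold, this, Real.sin_add_two_pi, Real.cos_add_two_pi]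
    · exact abs_mul_max_le (abs_approxSign_le _ _) (fold_le hw x) hb.le
    · exact abs_mul_max_le (abs_approxSign_le _ _) (fold_le hw x) hb.le
    · exact (tendsto_approxSign _).mul_const _
    · rw [sin_angle_reflect hw hs, fold_reflect hw hs, approxSign_neg, neg_mul]
    · rw [mem_union, not_or, mem_Ioi, mem_Iio, not_lt, not_lt] at hx
      rcases hy with hy | hy
      · refine ⟨b, by simp, ?_⟩
        rw [mem_Ioi] at hy
        rw [abs_of_pos (by linarith), abs_of_pos (by linarith)]
        linarith
      · refine ⟨-a, by simp, ?_⟩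
        rw [mem_Iio] at hy
        rw [abs_of_neg (by linarith), abs_of_neg (by linarith)]
        linarith
  · filter_upwards [ae_gaussian_ne b, ae_gaussian_ne (-a)] with x hx hx' hxb
    rw [mem_union, not_or, mem_Ioi, mem_Iio, not_lt, not_lt] at hxb
    exact oddPeriodic_of_mem hw ⟨lt_of_le_of_ne hxb.2 hx'.symm, lt_of_le_of_ne hxb.1 hx⟩

/-- The mean of the positive part of `B 1` on the event that `B` crosses both levels. -/
theorem setIntegral_enter_inter (hB : IsBrownianReal B P) (ha : 0 < a) (hb : 0 < b) :
    ∫ ω in {ω | ∃ t ≤ (1 : ℝ≥0), b < B t ω} ∩ {ω | ∃ t ≤ (1 : ℝ≥0), B t ω < -a},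
      max (B 1 ω) 0 ∂P =
      ∫ x, max (-2 * a - x) 0 ∂(gaussianReal 0 1) - ∫ x, oddAbout b x ∂(gaussianReal 0 1) +
        ∫ x, oddPeriodic a b x ∂(gaussianReal 0 1) := by
  have hlaw : HasLaw (B 1) (gaussianReal 0 1) P := hB.hasLaw_eval 1
  have hint : Integrable (fun ω ↦ max (B 1 ω) 0) P := by
    have hh := integrable_max_gaussian
    rw [← hlaw.map_eq] at hh
    exact hh.comp_aemeasurable hlaw.aemeasurable
  have h1 := setIntegral_enter_Ioi hB hb
  have h2 := setIntegral_enter_Iio hB ha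
  have h3 := setIntegral_enter_union hB ha hb
  have hs : {ω | ∃ t ≤ (1 : ℝ≥0), B t ω ∈ Ioi b ∪ Iio (-a)} =
      {ω | ∃ t ≤ (1 : ℝ≥0), b < B t ω} ∪ {ω | ∃ t ≤ (1 : ℝ≥0), B t ω < -a} := by
    ext ω
    simp only [mem_union, mem_Ioi, mem_Iio, mem_ofPred_eq, ← exists_or, ← and_or_left]
  simp only [mem_Ioi, mem_Iio] at h1 h2
  rw [hs] at h3
  have hm1 : NullMeasurableSet {ω | ∃ t ≤ (1 : ℝ≥0), b < B t ω} P :=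
    nullMeasurableSet_enter hB isOpen_Ioi
  have hm2 : NullMeasurableSet {ω | ∃ t ≤ (1 : ℝ≥0), B t ω < -a} P :=
    nullMeasurableSet_enter hB isOpen_Iio
  have h4 : ∀ s t : Set Ω, NullMeasurableSet s P → NullMeasurableSet t P →
      ∫ ω in s ∪ t, max (B 1 ω) 0 ∂P + ∫ ω in s ∩ t, max (B 1 ω) 0 ∂P =
      ∫ ω in s, max (B 1 ω) 0 ∂P + ∫ ω in t, max (B 1 ω) 0 ∂P := by
    intro s t hs ht
    rw [← integral_indicator₀ (hs.union ht), ← integral_indicator₀ (hs.inter ht),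
      ← integral_indicator₀ hs, ← integral_indicator₀ ht,
      ← integral_add (hint.indicator₀ (hs.union ht)) (hint.indicator₀ (hs.inter ht)),
      ← integral_add (hint.indicator₀ hs) (hint.indicator₀ ht)]
    exact integral_congr_ae (ae_of_all _ fun ω ↦ indicator_union_add_inter_apply _ _ _ _)
  have := h4 _ _ hm1 hm2
  linarith

end JointCrossing

/-! ### Gaussian integrals of the extensions as image series. -/

section Density

/-- The standard normal density. -/
noncomputable def phi (x : ℝ) : ℝ := gaussianPDFReal 0 1 x

lemma phi_eq (x : ℝ) : phi x = (√(2 * Real.pi))⁻¹ * Real.exp (-(1 / 2) * x ^ 2) := by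
  simp only [phi, gaussianPDFReal, NNReal.coe_one, mul_one, sub_zero]
  congr 2
  ring

lemma phi_neg (x : ℝ) : phi (-x) = phi x := by simp [phi_eq]

lemma phi_nonneg (x : ℝ) : 0 ≤ phi x := gaussianPDFReal_nonneg _ _ _

@[fun_prop]
lemma continuous_phi : Continuous phi := by
  simp_rw [funext phi_eq]
  fun_prop

@[fun_prop]
lemma measurable_phi : Measurable phi := continuous_phi.measurable

lemma phi_le_phi {x y : ℝ} (h0 : 0 ≤ x) (h : x ≤ y) : phi y ≤ phi x := by
  rw [phi_eq, phi_eq]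
  gcongr ?_ * Real.exp ?_
  nlinarith

lemma integrable_phi : Integrable phi := integrable_gaussianPDFReal 0 1

lemma integral_gaussian (f : ℝ → ℝ) :
    ∫ x, f x ∂(gaussianReal 0 1) = ∫ x, phi x * f x :=
  integral_gaussianReal_eq_integral_smul one_ne_zero

lemma integrable_mul_phi_add (c : ℝ) : Integrable (fun x ↦ x * phi (x + c)) := by
  have h1 : Integrable (fun x ↦ x * phi x) := by
    refine ((integrable_mul_exp_neg_mul_sq (by norm_num : (0 : ℝ) < 1 / 2)).const_mul
      (√(2 * Real.pi))⁻¹).congr (ae_of_all _ fun x ↦ ?_)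
    simp only [phi_eq]
    ring
  have h2 := (h1.sub (integrable_phi.const_mul c)).comp_add_right c
  refine h2.congr (ae_of_all _ fun x ↦ ?_)
  simp only [Pi.sub_apply]
  ring

variable {a b : ℝ}

lemma integral_max_reflect_gaussian :
    ∫ x, max (-2 * a - x) 0 ∂(gaussianReal 0 1) = ∫ x in Ioi 0, x * phi (x + 2 * a) := by
  rw [integral_gaussian, ← integral_sub_left_eq_self _ _ (-2 * a),
    ← integral_indicator measurableSet_Ioi]
  refine integral_congr_ae (ae_of_all _ fun x ↦ ?_)
  simp only [sub_sub_cancel]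
  rw [← phi_neg, show -(-2 * a - x) = x + 2 * a by ring, mul_comm]
  by_cases hx : 0 < x
  · rw [indicator_of_mem (by exact hx), max_eq_left hx.le]
  · rw [indicator_of_notMem (by exact hx), max_eq_right (not_lt.1 hx), zero_mul]

lemma intervalIntegrable_mul_phi_add (c u v : ℝ) :
    IntervalIntegrable (fun x ↦ x * phi (x + c)) volume u v :=
  (by fun_prop : Continuous fun x ↦ x * phi (x + c)).intervalIntegrable _ _

lemma intervalIntegrable_mul_phi_sub (c u v : ℝ) :
    IntervalIntegrable (fun x ↦ x * phi (c - x)) volume u v :=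
  (by fun_prop : Continuous fun x ↦ x * phi (c - x)).intervalIntegrable _ _

lemma integral_oddAbout_gaussian (hb : 0 < b) :
    ∫ x, oddAbout b x ∂(gaussianReal 0 1) =
      (∫ x in 0..b, x * phi x) - ∫ x in 0..b, x * phi (2 * b - x) := by
  have hz : ∀ x ∉ Ioc 0 (2 * b), phi x * oddAbout b x = 0 := by
    intro x hx
    rw [mem_Ioc, not_and_or, not_lt, not_le] at hx
    rcases hx with h | h
    · rw [oddAbout_of_lt (by linarith), max_eq_right h, mul_zero]
    · rw [oddAbout_of_gt (by linarith), max_eq_right (by linarith), neg_zero, mul_zero]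
  have hi : ∀ u v, IntervalIntegrable (fun x ↦ phi x * oddAbout b x) volume u v := fun u v ↦
    (integrable_phi.mul_bdd measurable_oddAbout.aestronglyMeasurable
      (ae_of_all _ fun x ↦ abs_oddAbout_le hb x)).intervalIntegrable
  rw [integral_gaussian, ← setIntegral_eq_integral_of_forall_compl_eq_zero hz,
    ← intervalIntegral.integral_of_le (by linarith),
    ← intervalIntegral.integral_add_adjacent_intervals (hi 0 b) (hi b (2 * b)), sub_eq_add_neg]
  congr 1
  · refine intervalIntegral.integral_congr_Ioo_of_le hb.le fun x hx ↦ ?_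
    simp only [oddAbout_of_lt hx.2, max_eq_left hx.1.le, mul_comm]
  · have h := intervalIntegral.integral_comp_sub_left (a := 0) (b := b)
      (fun x ↦ phi x * oddAbout b x) (2 * b)
    rw [sub_zero, show 2 * b - b = b by ring] at h
    rw [← h, ← intervalIntegral.integral_neg]
    refine intervalIntegral.integral_congr_Ioo_of_le hb.le fun x hx ↦ ?_
    rw [oddAbout_of_gt (by linarith [hx.2]), sub_sub_cancel, max_eq_left hx.1.le]
    ring

/-- Each period consists of a translate of the cell `(-a, b)` and its mirror image in `b`, and `g`
vanishes on the part `(-a, 0)` of the cell. The factor `c` is `-1` for the odd extension and `1` for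
its absolute value. -/
lemma hasSum_integral_phi_mul_periodic (ha : 0 < a) (hb : 0 < b) {g : ℝ → ℝ} {c : ℝ}
    (hg : Measurable g) (hgb : ∀ x, |g x| ≤ b)
    (hper : ∀ (k : ℤ) x, g (x + k • (2 * (a + b))) = g x)
    (hrefl : ∀ x, g (2 * b - x) = c * g x) (hcell : ∀ x ∈ Ioo (-a) b, g x = max x 0) :
    HasSum (fun k : ℤ ↦ (∫ x in 0..b, x * phi (x + k • (2 * (a + b)))) +
      c * ∫ x in 0..b, x * phi (2 * b + k • (2 * (a + b)) - x)) (∫ x, phi x * g x) := by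
  have hp : 0 < 2 * (a + b) := by positivity
  have hint : Integrable (fun x ↦ phi x * g x) :=
    integrable_phi.mul_bdd hg.aestronglyMeasurable (ae_of_all _ hgb)
  have h := hasSum_integral_iUnion (f := fun x ↦ phi x * g x) (μ := volume)
    (s := fun k : ℤ ↦ Ioc (-a + k • (2 * (a + b))) (-a + (k + 1) • (2 * (a + b))))
    (fun _ ↦ measurableSet_Ioc) (pairwise_disjoint_Ioc_add_zsmul _ _) hint.integrableOn
  rw [iUnion_Ioc_add_zsmul hp, setIntegral_univ] at h
  refine h.congr_fun fun k ↦ ?_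
  have hshift : ∀ x, phi (x + k • (2 * (a + b))) * g (x + k • (2 * (a + b))) =
      phi (x + k • (2 * (a + b))) * g x := fun x ↦ by rw [hper]
  have hi : ∀ u v, IntervalIntegrable (fun x ↦ phi (x + k • (2 * (a + b))) * g x) volume u v :=
    fun u v ↦ ((integrable_phi.comp_add_right _).mul_bdd hg.aestronglyMeasurable
      (ae_of_all _ hgb)).intervalIntegrable
  rw [← intervalIntegral.integral_of_le (by rw [add_one_zsmul]; linarith),
    show -a + (k + 1) • (2 * (a + b)) = (2 * b - -a) + k • (2 * (a + b)) by
      rw [add_one_zsmul]; ring,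
    ← intervalIntegral.integral_comp_add_right (fun x ↦ phi x * g x)]
  simp_rw [hshift]
  rw [← intervalIntegral.integral_add_adjacent_intervals (hi (-a) b) (hi b _)]
  have hzero : ∫ x in -a..0, phi (x + k • (2 * (a + b))) * g x = 0 := by
    rw [intervalIntegral.integral_congr_Ioo_of_le (g := fun _ ↦ (0 : ℝ)) (by linarith)
      fun x hx ↦ ?_, intervalIntegral.integral_zero]
    simp only [hcell x ⟨hx.1, by linarith [hx.2]⟩, max_eq_right hx.2.le, mul_zero]
  have hrefl' : ∫ x in b..2 * b - -a, phi (x + k • (2 * (a + b))) * g x =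
      c * ∫ x in -a..b, phi (2 * b + k • (2 * (a + b)) - x) * g x := by
    have h := intervalIntegral.integral_comp_sub_left (a := -a) (b := b)
      (fun x ↦ phi (x + k • (2 * (a + b))) * g x) (2 * b)
    rw [show 2 * b - b = b by ring] at h
    rw [← h, ← intervalIntegral.integral_const_mul]
    refine intervalIntegral.integral_congr fun x _ ↦ ?_
    rw [hrefl, show 2 * b - x + k • (2 * (a + b)) = 2 * b + k • (2 * (a + b)) - x by ring]
    ring
  have hi2 : ∀ u v, IntervalIntegrable (fun x ↦ phi (2 * b + k • (2 * (a + b)) - x) * g x)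
      volume u v :=
    fun u v ↦ ((integrable_phi.comp_sub_left _).mul_bdd hg.aestronglyMeasurable
      (ae_of_all _ hgb)).intervalIntegrable
  have hzero2 : ∫ x in -a..0, phi (2 * b + k • (2 * (a + b)) - x) * g x = 0 := by
    rw [intervalIntegral.integral_congr_Ioo_of_le (g := fun _ ↦ (0 : ℝ)) (by linarith)
      fun x hx ↦ ?_, intervalIntegral.integral_zero]
    simp only [hcell x ⟨hx.1, by linarith [hx.2]⟩, max_eq_right hx.2.le, mul_zero]
  rw [hrefl', ← intervalIntegral.integral_add_adjacent_intervals (hi (-a) 0) (hi 0 b), hzero,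
    ← intervalIntegral.integral_add_adjacent_intervals (hi2 (-a) 0) (hi2 0 b), hzero2, zero_add,
    zero_add]
  refine congrArg₂ _ ?_ (congrArg _ ?_)
  · refine intervalIntegral.integral_congr_Ioo_of_le hb.le fun x hx ↦ ?_
    simp only [hcell x ⟨by linarith [hx.1], hx.2⟩, max_eq_left hx.1.le, mul_comm]
  · refine intervalIntegral.integral_congr_Ioo_of_le hb.le fun x hx ↦ ?_
    simp only [hcell x ⟨by linarith [hx.1], hx.2⟩, max_eq_left hx.1.le, mul_comm]

/-- The sum of the four image densities at the index `k`, on `0 ≤ x ≤ b`. -/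
noncomputable def imageTerm (k : ℕ) (a b x : ℝ) : ℝ :=
  phi (2 * k * (a + b) - x) + phi (2 * k * (a + b) + x)
    - phi (2 * k * (a + b) + 2 * b - x) - phi (2 * k * (a + b) + 2 * a + x)

/-- Each positive image is paired with a negative one farther from the origin. The condition `1 ≤ k`
keeps all arguments nonnegative, where `phi` decreases. -/
lemma imageTerm_nonneg {k : ℕ} (hk : 1 ≤ k) (ha : 0 ≤ a) {x : ℝ} (hx : x ∈ Icc 0 b) :
    0 ≤ imageTerm k a b x := by
  have hk' : (1 : ℝ) ≤ k := by exact_mod_cast hk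
  have h1 : x ≤ 2 * k * (a + b) := by nlinarith [hx.1, hx.2]
  have h2 := phi_le_phi (x := 2 * k * (a + b) - x) (y := 2 * k * (a + b) + 2 * b - x)
    (by linarith) (by linarith [hx.1, hx.2])
  have h3 := phi_le_phi (x := 2 * k * (a + b) + x) (y := 2 * k * (a + b) + 2 * a + x)
    (by linarith [hx.1]) (by linarith [hx.1, hx.2])
  unfold imageTerm
  linarith

/-- Having both signs makes `e` and `d` summable separately, so the two-sided series can be
regrouped: `e` at `±k`, and `d` at `k` and `-(k + 1)`. The group `k = 0`, in which `e 0` occurs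
twice, is removed. -/
lemma hasSum_images {e d : ℤ → ℝ} {s t : ℝ} (h1 : HasSum (fun k ↦ e k + -1 * d k) s)
    (h2 : HasSum (fun k ↦ e k + 1 * d k) t) :
    HasSum (fun n : ℕ ↦ e (n + 1 : ℕ) + e (-(n + 1 : ℕ)) -
      (d (n + 1 : ℕ) + d (-((n + 1 : ℕ) + 1)))) (s - (e 0 - d 0) + d (-1)) := by
  have hE : HasSum e ((t + s) / 2) :=
    ((h2.add h1).div_const 2).congr_fun fun k ↦ by ring
  have hD : HasSum d ((t - s) / 2) :=
    ((h2.sub h1).div_const 2).congr_fun fun k ↦ by ring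
  have hED := hE.nat_add_neg.sub hD.nat_add_neg_add_one
  rw [← hasSum_nat_add_iff' 1] at hED
  rw [show s - (e 0 - d 0) + d (-1) = (t + s) / 2 + e 0 - (t - s) / 2 - ∑ i ∈ Finset.range 1,
    (e (i : ℕ) + e (-(i : ℕ)) - (d (i : ℕ) + d (-((i : ℕ) + 1)))) by
      rw [Finset.sum_range_one]
      simp only [Nat.cast_zero, neg_zero, zero_add]
      ring]
  exact hED

lemma hasSum_integral_imageTerm (ha : 0 < a) (hb : 0 < b) :
    HasSum (fun n : ℕ ↦ ∫ x in 0..b, x * imageTerm (n + 1) a b x)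
      (∫ x, oddPeriodic a b x ∂(gaussianReal 0 1) - ∫ x, oddAbout b x ∂(gaussianReal 0 1) +
        ∫ x in 0..b, x * phi (x + 2 * a)) := by
  have hw : 0 < a + b := by positivity
  have hper := oddPeriodic_add_period hw
  have hrefl := oddPeriodic_reflect (s := b) hw (Or.inl rfl)
  have hcell : ∀ x ∈ Ioo (-a) b, oddPeriodic a b x = max x 0 := fun x hx ↦
    oddPeriodic_of_mem hw hx
  have h1 := hasSum_integral_phi_mul_periodic ha hb (c := -1) measurable_oddPeriodic
    (abs_oddPeriodic_le ha hb) hper (fun x ↦ by rw [hrefl, neg_one_mul]) hcell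
  -- The absolute value flips the sign of the mirror images and so supplies the second series for
  -- `hasSum_images`.
  have h2 := hasSum_integral_phi_mul_periodic ha hb (g := fun x ↦ |oddPeriodic a b x|) (c := 1)
    measurable_oddPeriodic.abs (fun x ↦ by rw [abs_abs]; exact abs_oddPeriodic_le ha hb x)
    (fun k x ↦ by rw [hper]) (fun x ↦ by rw [hrefl, abs_neg, one_mul])
    (fun x hx ↦ by rw [hcell x hx, abs_of_nonneg (le_max_right _ _)])
  let e : ℤ → ℝ := fun k ↦ ∫ x in 0..b, x * phi (x + k • (2 * (a + b)))
  let d : ℤ → ℝ := fun k ↦ ∫ x in 0..b, x * phi (2 * b + k • (2 * (a + b)) - x)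
  have hED := hasSum_images (e := e) (d := d) h1 h2
  have hd1 : d (-1) = ∫ x in 0..b, x * phi (x + 2 * a) := by
    refine intervalIntegral.integral_congr fun x _ ↦ ?_
    rw [← phi_neg]
    congr 2
    rw [neg_one_zsmul]; ring
  have he0 : e 0 = ∫ x in 0..b, x * phi x := by simp [e]
  have hd0 : d 0 = ∫ x in 0..b, x * phi (2 * b - x) := by simp [d]
  rw [integral_oddAbout_gaussian hb, ← he0, ← hd0, ← hd1, integral_gaussian]
  refine hED.congr_fun fun n ↦ ?_
  symm
  simp only [e, d]
  rw [← intervalIntegral.integral_add (intervalIntegrable_mul_phi_add _ _ _)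
    (intervalIntegrable_mul_phi_add _ _ _),
    ← intervalIntegral.integral_add (intervalIntegrable_mul_phi_sub _ _ _)
    (intervalIntegrable_mul_phi_sub _ _ _), ← intervalIntegral.integral_sub]
  · refine intervalIntegral.integral_congr fun x _ ↦ ?_
    simp only [imageTerm, zsmul_eq_mul]
    rw [← phi_neg (x + ((-((n + 1 : ℕ) : ℤ) : ℤ) : ℝ) * _),
      ← phi_neg (2 * b + ((-(((n + 1 : ℕ) : ℤ) + 1) : ℤ) : ℝ) * _ - x)]
    push_cast
    ring_nf
  · exact (intervalIntegrable_mul_phi_add _ _ _).add (intervalIntegrable_mul_phi_add _ _ _)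
  · exact (intervalIntegrable_mul_phi_sub _ _ _).add (intervalIntegrable_mul_phi_sub _ _ _)

lemma integrableOn_mul_phi (c : ℝ) (s : Set ℝ) : IntegrableOn (fun x ↦ x * phi (x + c)) s :=
  (integrable_mul_phi_add c).integrableOn

/-- The image-series formula for the mean of the positive part of `B 1` on joint crossings. -/
theorem ofReal_crossing (ha : 0 < a) (hb : 0 < b) :
    ENNReal.ofReal (∫ x, max (-2 * a - x) 0 ∂(gaussianReal 0 1) -
      ∫ x, oddAbout b x ∂(gaussianReal 0 1) + ∫ x, oddPeriodic a b x ∂(gaussianReal 0 1)) =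
    (∫⁻ x in Ioi b, ENNReal.ofReal (x * phi (x + 2 * a))) +
      ∑' n : ℕ, ∫⁻ x in Ioc 0 b, ENNReal.ofReal (x * imageTerm (n + 1) a b x) := by
  have hs := hasSum_integral_imageTerm ha hb
  have hterm : ∀ n : ℕ, ∫⁻ x in Ioc 0 b, ENNReal.ofReal (x * imageTerm (n + 1) a b x) =
      ENNReal.ofReal (∫ x in 0..b, x * imageTerm (n + 1) a b x) := by
    intro n
    rw [intervalIntegral.integral_of_le hb.le, ofReal_integral_eq_lintegral_ofReal]
    · refine Continuous.integrableOn_Ioc ?_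
      unfold imageTerm
      fun_prop
    · filter_upwards [ae_restrict_mem measurableSet_Ioc] with x hx
      exact mul_nonneg hx.1.le (imageTerm_nonneg (by lia) ha.le (Ioc_subset_Icc_self hx))
  have hnn : ∀ n : ℕ, 0 ≤ ∫ x in 0..b, x * imageTerm (n + 1) a b x := fun n ↦ by
    rw [intervalIntegral.integral_of_le hb.le]
    exact setIntegral_nonneg measurableSet_Ioc fun x hx ↦
      mul_nonneg hx.1.le (imageTerm_nonneg (by lia) ha.le (Ioc_subset_Icc_self hx))
  simp_rw [hterm]
  rw [← ENNReal.ofReal_tsum_of_nonneg hnn hs.summable, hs.tsum_eq,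
    ← ofReal_integral_eq_lintegral_ofReal (integrableOn_mul_phi _ _), ← ENNReal.ofReal_add]
  · congr 1
    -- The part of the reflected integral over `(0, b]` cancels the image `d (-1)`, leaving only the
    -- integral over `(b, ∞)`.
    rw [integral_max_reflect_gaussian, ← Ioc_union_Ioi_eq_Ioi hb.le,
      setIntegral_union (Ioc_disjoint_Ioi le_rfl) measurableSet_Ioi (integrableOn_mul_phi _ _)
      (integrableOn_mul_phi _ _), intervalIntegral.integral_of_le hb.le]
    ring
  · exact setIntegral_nonneg measurableSet_Ioi fun x hx ↦
      mul_nonneg (hb.le.trans (le_of_lt hx)) (phi_nonneg _)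
  · rw [← hs.tsum_eq]
    exact tsum_nonneg hnn
  · filter_upwards [ae_restrict_mem measurableSet_Ioi] with x hx
    exact mul_nonneg (hb.le.trans (le_of_lt hx)) (phi_nonneg _)

end Density

/-! ### Integrals of `phi` of a linear form over the positive octant. -/

section SimplexIntegrals

/-- The `ℝ≥0∞`-valued restriction of a function to the nonnegative half-line. -/
noncomputable def pos (f : ℝ → ℝ) : ℝ → ℝ≥0∞ := (Ici 0).indicator fun x ↦ ENNReal.ofReal (f x)

lemma measurable_pos {f : ℝ → ℝ} (hf : Measurable f) : Measurable (pos f) :=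
  hf.ennreal_ofReal.indicator measurableSet_Ici

lemma pos_of_nonneg (f : ℝ → ℝ) {x : ℝ} (hx : 0 ≤ x) : pos f x = ENNReal.ofReal (f x) :=
  indicator_of_mem (by exact hx) _

lemma pos_of_neg (f : ℝ → ℝ) {x : ℝ} (hx : x < 0) : pos f x = 0 :=
  indicator_of_notMem (by simpa using hx) _

lemma pos_id (x : ℝ) : pos (fun x ↦ x) x = ENNReal.ofReal x := by
  rcases lt_or_ge x 0 with h | h
  · rw [pos_of_neg _ h, ENNReal.ofReal_of_nonpos h.le]
  · rw [pos_of_nonneg _ h]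

lemma lintegral_comp_mul_left_pos {c : ℝ} (hc : 0 < c) {f : ℝ → ℝ≥0∞} (hf : Measurable f) :
    ∫⁻ x, f (c * x) = ENNReal.ofReal c⁻¹ * ∫⁻ x, f x := by
  rw [← lintegral_map hf (by fun_prop : Measurable fun x ↦ c * x),
    Real.map_volume_mul_left hc.ne', lintegral_smul_measure, abs_of_pos (inv_pos.2 hc), smul_eq_mul]

/-- With `s = u + v`, the inner integral is the convolution of `f` and `g` over `[0, s]`. Used
twice, it reduces the octant integral to a Gaussian moment. -/
lemma lintegral_pos_conv {f g r : ℝ → ℝ} (hf : Continuous f) (hg : Continuous g)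
    (hf0 : ∀ x, 0 ≤ x → 0 ≤ f x) (hg0 : ∀ x, 0 ≤ x → 0 ≤ g x)
    (hr : ∀ s, 0 ≤ s → ∫ u in 0..s, f u * g (s - u) = r s) {h : ℝ → ℝ≥0∞} (hh : Measurable h) :
    ∫⁻ u, ∫⁻ v, pos f u * pos g v * h (u + v) = ∫⁻ s, pos r s * h s := by
  have mf := measurable_pos hf.measurable
  have mg := measurable_pos hg.measurable
  have h1 : ∀ u, ∫⁻ v, pos f u * pos g v * h (u + v) = ∫⁻ s, pos f u * pos g (s - u) * h s := by
    intro u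
    rw [← lintegral_sub_right_eq_self _ u]
    simp only [add_sub_cancel]
  simp_rw [h1]
  rw [lintegral_lintegral_swap (by fun_prop)]
  refine lintegral_congr fun s ↦ ?_
  rw [lintegral_mul_const _ (by fun_prop)]
  congr 1
  rcases lt_or_ge s 0 with hs | hs
  · rw [pos_of_neg _ hs]
    refine (lintegral_congr fun u ↦ ?_).trans lintegral_zero
    rcases lt_or_ge u 0 with hu | hu
    · rw [pos_of_neg _ hu, zero_mul]
    · rw [pos_of_neg g (by linarith), mul_zero]
  · have h2 : ∀ u, pos f u * pos g (s - u) =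
        (Icc 0 s).indicator (fun u ↦ ENNReal.ofReal (f u * g (s - u))) u := by
      intro u
      by_cases hu : u ∈ Icc 0 s
      · rw [indicator_of_mem hu, pos_of_nonneg _ hu.1, pos_of_nonneg _ (sub_nonneg.2 hu.2),
          ENNReal.ofReal_mul (hf0 u hu.1)]
      · rw [indicator_of_notMem hu]
        rw [mem_Icc, not_and_or, not_le, not_le] at hu
        rcases hu with hu | hu
        · rw [pos_of_neg _ hu, zero_mul]
        · rw [pos_of_neg g (by linarith), mul_zero]
    simp_rw [h2]
    rw [lintegral_indicator measurableSet_Icc, pos_of_nonneg _ hs, ← hr s hs,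
      intervalIntegral.integral_of_le hs, ← integral_Icc_eq_integral_Ioc,
      ofReal_integral_eq_lintegral_ofReal]
    · exact Continuous.integrableOn_Icc (by fun_prop)
    · filter_upwards [ae_restrict_mem measurableSet_Icc] with u hu
      exact mul_nonneg (hf0 u hu.1) (hg0 _ (sub_nonneg.2 hu.2))

lemma integral_pow_four_mul_phi : ∫ x in Ioi 0, x ^ 4 * phi x = 3 / 2 := by
  have h := integral_rpow_mul_exp_neg_mul_rpow (p := 2) (q := 4) (b := 1 / 2) (by norm_num)
    (by norm_num) (by norm_num)
  have h2 : ∫ x in Ioi (0 : ℝ), x ^ 4 * phi x = (√(2 * Real.pi))⁻¹ *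
      ∫ x in Ioi (0 : ℝ), x ^ (4 : ℝ) * Real.exp (-(1 / 2) * x ^ (2 : ℝ)) := by
    rw [← integral_const_mul]
    refine integral_congr_ae (ae_of_all _ fun x ↦ ?_)
    beta_reduce
    rw [phi_eq, ← Real.rpow_natCast x 4, ← Real.rpow_natCast x 2]
    push_cast
    ring
  rw [h2, h]
  have hG : Real.Gamma ((4 + 1) / 2) = 3 / 4 * √Real.pi := by
    rw [show ((4 + 1) / 2 : ℝ) = 3 / 2 + 1 by norm_num, Real.Gamma_add_one (by norm_num),
      show (3 / 2 : ℝ) = 1 / 2 + 1 by norm_num, Real.Gamma_add_one (by norm_num),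
      Real.Gamma_one_half_eq]
    ring
  have hp : (1 / 2 : ℝ) ^ (-(4 + 1) / 2 : ℝ) = 4 * √2 := by
    rw [one_div, Real.inv_rpow (by norm_num), ← Real.rpow_neg (by norm_num),
      show (-(-(4 + 1) / 2) : ℝ) = 2 + 1 / 2 by norm_num, Real.rpow_add (by norm_num),
      ← Real.sqrt_eq_rpow]
    norm_num
  rw [hG, hp, Real.sqrt_mul (by norm_num)]
  have h1 : √Real.pi ≠ 0 := by positivity
  have h3 : √(2 : ℝ) ≠ 0 := by positivity
  field_simp

lemma lintegral_pos_pow_four_mul_phi :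
    ∫⁻ s, pos (fun s ↦ s ^ 4 / 24) s * ENNReal.ofReal (phi s) = ENNReal.ofReal (1 / 16) := by
  have h : ∀ s, pos (fun s ↦ s ^ 4 / 24) s * ENNReal.ofReal (phi s) =
      (Ici 0).indicator (fun s ↦ ENNReal.ofReal (1 / 24 * (s ^ 4 * phi s))) s := by
    intro s
    by_cases hs : s ∈ Ici (0 : ℝ)
    · rw [indicator_of_mem hs, pos_of_nonneg _ hs, ← ENNReal.ofReal_mul (by positivity)]
      ring_nf
    · rw [indicator_of_notMem hs, pos_of_neg _ (by simpa using hs), zero_mul]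
  simp_rw [h]
  have hi : IntegrableOn (fun s ↦ s ^ 4 * phi s) (Ioi 0) := by
    -- A non-integrable function would have integral `0`, but the value is `3 / 2`.
    refine not_imp_comm.1 integral_undef ?_
    rw [integral_pow_four_mul_phi]
    norm_num
  rw [lintegral_indicator measurableSet_Ici, setLIntegral_congr Ioi_ae_eq_Ici.symm,
    ← ofReal_integral_eq_lintegral_ofReal (hi.const_mul _), integral_const_mul,
    integral_pow_four_mul_phi]
  · norm_num
  · exact ae_of_all _ fun s ↦ by have := phi_nonneg s; positivity

lemma lintegral_pos_sq_mul_pos_id :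
    ∫⁻ s, ∫⁻ a, pos (fun s ↦ s ^ 2 / 2) s * pos (fun a ↦ a) a * ENNReal.ofReal (phi (s + a)) =
      ENNReal.ofReal (1 / 16) := by
  rw [lintegral_pos_conv (r := fun s ↦ s ^ 4 / 24) (h := fun s ↦ ENNReal.ofReal (phi s))
    (by fun_prop) (by fun_prop) (fun x _ ↦ by positivity) (fun x hx ↦ hx) (fun s _ ↦ ?_)
    (by fun_prop), lintegral_pos_pow_four_mul_phi]
  have : ∀ u : ℝ, u ^ 2 / 2 * (s - u) = s / 2 * u ^ 2 - 1 / 2 * u ^ 3 := fun u ↦ by ring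
  simp_rw [this]
  rw [intervalIntegral.integral_sub (Continuous.intervalIntegrable (by fun_prop) _ _)
    (Continuous.intervalIntegrable (by fun_prop) _ _), intervalIntegral.integral_const_mul,
    intervalIntegral.integral_const_mul, integral_pow, integral_pow]
  norm_num
  ring

lemma lintegral_pos_simplex :
    ∫⁻ x, ∫⁻ y, ∫⁻ a, pos (fun x ↦ x) x * pos (fun _ ↦ 1) y * pos (fun a ↦ a) a *
      ENNReal.ofReal (phi (x + y + a)) = ENNReal.ofReal (1 / 16) := by
  have m1 := measurable_pos (f := fun x ↦ x) measurable_id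
  have h1 : ∀ x y, ∫⁻ a, pos (fun x ↦ x) x * pos (fun _ ↦ 1) y * pos (fun a ↦ a) a *
      ENNReal.ofReal (phi (x + y + a)) = pos (fun x ↦ x) x * pos (fun _ ↦ 1) y *
      ∫⁻ a, pos (fun a ↦ a) a * ENNReal.ofReal (phi (x + y + a)) := by
    intro x y
    rw [← lintegral_const_mul _ (by fun_prop)]
    simp only [mul_assoc]
  simp_rw [h1]
  rw [lintegral_pos_conv (r := fun s ↦ s ^ 2 / 2)
    (h := fun s ↦ ∫⁻ a, pos (fun a ↦ a) a * ENNReal.ofReal (phi (s + a)))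
    (by fun_prop) (by fun_prop) (fun x hx ↦ hx) (fun x _ ↦ zero_le_one) (fun s _ ↦ by simp)
    (Measurable.lintegral_prod_right' (f := fun p : ℝ × ℝ ↦ pos (fun a ↦ a) p.2 *
      ENNReal.ofReal (phi (p.1 + p.2))) (by fun_prop)), ← lintegral_pos_sq_mul_pos_id]
  refine lintegral_congr fun s ↦ ?_
  rw [← lintegral_const_mul _ (by fun_prop)]
  simp only [mul_assoc]

/-- The Jacobian contributes `1 / (α β γ)` and the weights `x` and `a` a further `1 / (α β)`. -/
lemma lintegral_pos_simplex_scaled {α β γ : ℝ} (hα : 0 < α) (hβ : 0 < β) (hγ : 0 < γ) :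
    ∫⁻ x, ∫⁻ y, ∫⁻ a, pos (fun x ↦ x) x * pos (fun _ ↦ 1) y * pos (fun a ↦ a) a *
      ENNReal.ofReal (phi (β * x + γ * y + α * a)) =
      ENNReal.ofReal (1 / (16 * α ^ 2 * β ^ 2 * γ)) := by
  have m1 := measurable_pos (f := fun x ↦ x) measurable_id
  have m2 := measurable_pos (f := fun _ ↦ 1) measurable_const
  have hid : ∀ {c : ℝ}, 0 < c → ∀ x, pos (fun x ↦ x) x =
      ENNReal.ofReal c⁻¹ * pos (fun x ↦ x) (c * x) := fun {c} hc x ↦ by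
    rw [pos_id, pos_id, ← ENNReal.ofReal_mul (by positivity), inv_mul_cancel_left₀ hc.ne']
  have hone : ∀ y, pos (fun _ ↦ 1) y = pos (fun _ ↦ 1) (γ * y) := fun y ↦ by
    rcases lt_or_ge y 0 with h | h
    · rw [pos_of_neg _ h, pos_of_neg _ (mul_neg_of_pos_of_neg hγ h)]
    · rw [pos_of_nonneg _ h, pos_of_nonneg _ (by positivity)]
  let G : ℝ → ℝ → ℝ → ℝ≥0∞ := fun x y a ↦ pos (fun x ↦ x) x * pos (fun _ ↦ 1) y *
    pos (fun a ↦ a) a * ENNReal.ofReal (phi (x + y + a))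
  have hG3 : Measurable fun p : (ℝ × ℝ) × ℝ ↦ G p.1.1 p.1.2 p.2 := by
    simp only [G]; fun_prop
  have hG2 : Measurable fun p : ℝ × ℝ ↦ ∫⁻ a, G p.1 p.2 a := hG3.lintegral_prod_right'
  have hG1 : Measurable fun x : ℝ ↦ ∫⁻ y, ∫⁻ a, G x y a := hG2.lintegral_prod_right'
  have h1 : ∀ x y a, pos (fun x ↦ x) x * pos (fun _ ↦ 1) y * pos (fun a ↦ a) a *
      ENNReal.ofReal (phi (β * x + γ * y + α * a)) =
      ENNReal.ofReal (β⁻¹ * α⁻¹) * G (β * x) (γ * y) (α * a) := by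
    intro x y a
    rw [hid hβ x, hid hα a, hone y, ENNReal.ofReal_mul (by positivity)]
    simp only [G]
    ring
  have h2 : ∀ x y, ∫⁻ a, ENNReal.ofReal (β⁻¹ * α⁻¹) * G (β * x) (γ * y) (α * a) =
      ENNReal.ofReal (β⁻¹ * α⁻¹ * α⁻¹) * ∫⁻ a, G (β * x) (γ * y) a := by
    intro x y
    rw [lintegral_const_mul _ (by simp only [G]; fun_prop),
      lintegral_comp_mul_left_pos hα (f := fun a ↦ G (β * x) (γ * y) a) (by simp only [G]; fun_prop),
      ← mul_assoc, ← ENNReal.ofReal_mul (by positivity)]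
  have h3 : ∀ x, ∫⁻ y, ENNReal.ofReal (β⁻¹ * α⁻¹ * α⁻¹) * ∫⁻ a, G (β * x) (γ * y) a =
      ENNReal.ofReal (β⁻¹ * α⁻¹ * α⁻¹ * γ⁻¹) * ∫⁻ y, ∫⁻ a, G (β * x) y a := by
    intro x
    have hm : Measurable fun y ↦ ∫⁻ a, G (β * x) (γ * y) a :=
      hG2.comp (by fun_prop : Measurable fun y ↦ (β * x, γ * y))
    rw [lintegral_const_mul _ hm,
      lintegral_comp_mul_left_pos hγ (f := fun y ↦ ∫⁻ a, G (β * x) y a)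
        (hG2.comp (by fun_prop : Measurable fun y ↦ (β * x, y))),
      ← mul_assoc, ← ENNReal.ofReal_mul (by positivity)]
  simp_rw [h1, h2, h3]
  have hm : Measurable fun x ↦ ∫⁻ y, ∫⁻ a, G (β * x) y a :=
    hG1.comp (by fun_prop : Measurable fun x ↦ β * x)
  rw [lintegral_const_mul _ hm,
    lintegral_comp_mul_left_pos hβ (f := fun x ↦ ∫⁻ y, ∫⁻ a, G x y a) hG1, ← mul_assoc,
    ← ENNReal.ofReal_mul (by positivity)]
  simp only [G]
  rw [lintegral_pos_simplex, ← ENNReal.ofReal_mul (by positivity)]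
  congr 1
  field_simp

end SimplexIntegrals

/-! ### Integrating the crossing formula over both levels. -/

section CrossingIntegral

lemma setLIntegral_Ioi_eq {f : ℝ → ℝ≥0∞} (hf : ∀ x ≤ 0, f x = 0) :
    ∫⁻ x in Ioi 0, f x = ∫⁻ x, f x := by
  rw [← lintegral_indicator measurableSet_Ioi]
  refine lintegral_congr fun x ↦ ?_
  by_cases hx : 0 < x
  · rw [indicator_of_mem (by exact hx)]
  · rw [indicator_of_notMem (by exact hx), hf x (not_lt.1 hx)]

lemma pos_id_of_nonpos {x : ℝ} (hx : x ≤ 0) : pos (fun x ↦ x) x = 0 := by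
  rw [pos_id, ENNReal.ofReal_of_nonpos hx]

/-- The weight `a x` on the region `0 ≤ a`, `0 ≤ x ≤ b`. -/
noncomputable def weight (b a x : ℝ) : ℝ≥0∞ :=
  pos (fun x ↦ x) x * pos (fun _ ↦ 1) (b - x) * pos (fun a ↦ a) a

lemma measurable_weight : Measurable fun p : (ℝ × ℝ) × ℝ ↦ weight p.1.1 p.1.2 p.2 := by
  have m1 := measurable_pos (f := fun x ↦ x) measurable_id
  have m2 := measurable_pos (f := fun _ ↦ 1) measurable_const
  unfold weight
  fun_prop

lemma lintegral_weight_phi {α β γ : ℝ} (hα : 0 < α) (hβ : 0 < β) (hγ : 0 < γ) :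
    ∫⁻ b in Ioi 0, ∫⁻ a in Ioi 0, ∫⁻ x, weight b a x *
      ENNReal.ofReal (phi (β * x + γ * (b - x) + α * a)) =
      ENNReal.ofReal (1 / (16 * α ^ 2 * β ^ 2 * γ)) := by
  let F : ℝ → ℝ → ℝ → ℝ≥0∞ := fun b a x ↦ weight b a x *
      ENNReal.ofReal (phi (β * x + γ * (b - x) + α * a))
  have mF : Measurable fun p : (ℝ × ℝ) × ℝ ↦ F p.1.1 p.1.2 p.2 :=
    measurable_weight.mul (by fun_prop)
  have mF2 : Measurable fun p : (ℝ × ℝ) × ℝ ↦ F p.1.1 p.2 p.1.2 :=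
    mF.comp (by fun_prop : Measurable fun p : (ℝ × ℝ) × ℝ ↦ ((p.1.1, p.2), p.1.2))
  have mF3 : Measurable fun p : ℝ × ℝ ↦ ∫⁻ a, F p.1 a p.2 := mF2.lintegral_prod_right'
  have h1 : ∀ b, ∫⁻ a in Ioi 0, ∫⁻ x, F b a x = ∫⁻ x, ∫⁻ a, F b a x := by
    intro b
    rw [lintegral_lintegral_swap]
    · refine lintegral_congr fun x ↦ setLIntegral_Ioi_eq fun a ha ↦ ?_
      simp only [F, weight, pos_id_of_nonpos ha, mul_zero, zero_mul]
    · exact (mF.comp (by fun_prop : Measurable fun p : ℝ × ℝ ↦ ((b, p.1), p.2))).aemeasurable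
  change ∫⁻ b in Ioi 0, ∫⁻ a in Ioi 0, ∫⁻ x, F b a x = _
  simp_rw [h1]
  rw [setLIntegral_Ioi_eq, lintegral_lintegral_swap mF3.aemeasurable,
    ← lintegral_pos_simplex_scaled hα hβ hγ]
  · refine lintegral_congr fun x ↦ ?_
    -- Substituting `b = x + y` turns the region `0 ≤ x ≤ b` into the quadrant `x, y ≥ 0`.
    rw [← lintegral_add_right_eq_self _ x]
    simp only [F, weight, add_sub_cancel_right]
  · intro b hb
    refine (lintegral_congr fun x ↦ (lintegral_congr fun a ↦ ?_).trans lintegral_zero).trans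
      lintegral_zero
    simp only [F, weight]
    rcases le_or_gt x 0 with hx | hx
    · simp [pos_id_of_nonpos hx]
    · simp [pos_of_neg (fun _ ↦ 1) (show b - x < 0 by linarith)]

/-- The contribution of the `k`-th image term. -/
noncomputable def imageCoeff (k : ℝ) : ℝ :=
  1 / ((2 * k) ^ 3 * (2 * k - 1) ^ 2) + 1 / ((2 * k) ^ 3 * (2 * k + 1) ^ 2)
    - 1 / ((2 * k) ^ 2 * (2 * k + 1) ^ 2 * (2 * k + 2))
    - 1 / ((2 * k + 2) ^ 2 * (2 * k + 1) ^ 2 * (2 * k))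

lemma lintegral_weight_imageTerm {k : ℕ} (hk : 1 ≤ k) :
    ∫⁻ b in Ioi 0, ∫⁻ a in Ioi 0, ∫⁻ x, weight b a x * ENNReal.ofReal (imageTerm k a b x) =
      ENNReal.ofReal (imageCoeff k / 16) := by
  have hk' : (1 : ℝ) ≤ k := by exact_mod_cast hk
  have hk2 : (0 : ℝ) < 2 * k - 1 := by linarith
  let μ : Measure ((ℝ × ℝ) × ℝ) :=
    ((volume.restrict (Ioi 0)).prod (volume.restrict (Ioi 0))).prod volume
  have hμ : ∀ {F : ℝ → ℝ → ℝ → ℝ≥0∞}, Measurable (fun p : (ℝ × ℝ) × ℝ ↦ F p.1.1 p.1.2 p.2) →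
      ∫⁻ b in Ioi 0, ∫⁻ a in Ioi 0, ∫⁻ x, F b a x = ∫⁻ p, F p.1.1 p.1.2 p.2 ∂μ := by
    intro F hF
    rw [lintegral_prod _ hF.aemeasurable, lintegral_prod _ hF.lintegral_prod_right'.aemeasurable]
  have hlin : ∀ α β γ : ℝ, 0 < α → 0 < β → 0 < γ → ∀ g : (ℝ × ℝ) × ℝ → ℝ,
      (∀ p, g p = phi (β * p.2 + γ * (p.1.1 - p.2) + α * p.1.2)) →
      ∫⁻ p, weight p.1.1 p.1.2 p.2 * ENNReal.ofReal (g p) ∂μ =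
      ENNReal.ofReal (1 / (16 * α ^ 2 * β ^ 2 * γ)) := by
    intro α β γ hα hβ hγ g hg
    simp_rw [hg]
    rw [← lintegral_weight_phi hα hβ hγ]
    exact (hμ (F := fun b a x ↦ weight b a x *
      ENNReal.ofReal (phi (β * x + γ * (b - x) + α * a)))
      (measurable_weight.mul (by fun_prop))).symm
  -- The triples are the coefficients of `a`, `x` and `b - x` in the arguments of the four images,
  -- e.g. `2k(a + b) - x = 2k a + (2k - 1) x + 2k (b - x)`.
  have i1 := hlin (2 * k) (2 * k - 1) (2 * k) (by positivity) hk2 (by positivity)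
    (fun p ↦ phi (2 * k * (p.1.2 + p.1.1) - p.2)) (fun p ↦ by ring_nf)
  have i2 := hlin (2 * k) (2 * k + 1) (2 * k) (by positivity) (by positivity) (by positivity)
    (fun p ↦ phi (2 * k * (p.1.2 + p.1.1) + p.2)) (fun p ↦ by ring_nf)
  have i3 := hlin (2 * k) (2 * k + 1) (2 * k + 2) (by positivity) (by positivity) (by positivity)
    (fun p ↦ phi (2 * k * (p.1.2 + p.1.1) + 2 * p.1.1 - p.2)) (fun p ↦ by ring_nf)
  have i4 := hlin (2 * k + 2) (2 * k + 1) (2 * k) (by positivity) (by positivity) (by positivity)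
    (fun p ↦ phi (2 * k * (p.1.2 + p.1.1) + 2 * p.1.2 + p.2)) (fun p ↦ by ring_nf)
  have mT : Measurable fun p : (ℝ × ℝ) × ℝ ↦ imageTerm k p.1.2 p.1.1 p.2 := by
    unfold imageTerm; fun_prop
  rw [hμ (measurable_weight.mul mT.ennreal_ofReal)]
  -- Subtraction in `ℝ≥0∞` is truncated, so the two negative images are first moved to the other
  -- side.
  have hsum : ∫⁻ p, weight p.1.1 p.1.2 p.2 * ENNReal.ofReal (imageTerm k p.1.2 p.1.1 p.2) ∂μ +
      (∫⁻ p, weight p.1.1 p.1.2 p.2 *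
          ENNReal.ofReal (phi (2 * k * (p.1.2 + p.1.1) + 2 * p.1.1 - p.2)) ∂μ +
        ∫⁻ p, weight p.1.1 p.1.2 p.2 *
          ENNReal.ofReal (phi (2 * k * (p.1.2 + p.1.1) + 2 * p.1.2 + p.2)) ∂μ) =
      ∫⁻ p, weight p.1.1 p.1.2 p.2 *
          ENNReal.ofReal (phi (2 * k * (p.1.2 + p.1.1) - p.2)) ∂μ +
        ∫⁻ p, weight p.1.1 p.1.2 p.2 *
          ENNReal.ofReal (phi (2 * k * (p.1.2 + p.1.1) + p.2)) ∂μ := by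
    have mw := measurable_weight
    have hadd : ∀ g h : (ℝ × ℝ) × ℝ → ℝ≥0∞, Measurable g →
        ∫⁻ p, weight p.1.1 p.1.2 p.2 * g p ∂μ + ∫⁻ p, weight p.1.1 p.1.2 p.2 * h p ∂μ =
        ∫⁻ p, weight p.1.1 p.1.2 p.2 * (g p + h p) ∂μ := fun g h hg ↦ by
      simp_rw [mul_add]
      exact (lintegral_add_left (mw.mul hg) _).symm
    rw [hadd _ _ (by fun_prop), hadd _ _ mT.ennreal_ofReal, hadd _ _ (by fun_prop)]
    refine lintegral_congr fun p ↦ ?_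
    obtain ⟨⟨b, a⟩, x⟩ := p
    dsimp only
    by_cases h : 0 ≤ x ∧ x ≤ b ∧ 0 ≤ a
    · congr 1
      rw [← ENNReal.ofReal_add (phi_nonneg _) (phi_nonneg _),
        ← ENNReal.ofReal_add (phi_nonneg _) (phi_nonneg _),
        ← ENNReal.ofReal_add (imageTerm_nonneg hk h.2.2 ⟨h.1, h.2.1⟩)
          (add_nonneg (phi_nonneg _) (phi_nonneg _))]
      congr 1
      unfold imageTerm
      ring
    · have : weight b a x = 0 := by
        unfold weight
        rw [not_and_or, not_and_or, not_le, not_le, not_le] at h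
        rcases h with h | h | h
        · simp [pos_of_neg _ h]
        · simp [pos_of_neg (fun _ ↦ 1) (show b - x < 0 by linarith)]
        · simp [pos_of_neg _ h]
      rw [this, zero_mul, zero_mul]
  rw [i1, i2, i3, i4, ← ENNReal.ofReal_add (by positivity) (by positivity),
    ← ENNReal.ofReal_add (by positivity) (by positivity)] at hsum
  rw [ENNReal.eq_sub_of_add_eq ENNReal.ofReal_ne_top hsum, ← ENNReal.ofReal_sub _ (by positivity)]
  congr 1
  unfold imageCoeff
  field_simp
  ring

lemma lintegral_far_crossing :
    ∫⁻ b in Ioi 0, ∫⁻ a in Ioi 0, ENNReal.ofReal (2 * a) *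
      ∫⁻ x in Ioi b, ENNReal.ofReal (x * phi (x + 2 * a)) = ENNReal.ofReal (1 / 16) := by
  have m1 := measurable_pos (f := fun x ↦ x) measurable_id
  have m2 := measurable_pos (f := fun _ ↦ 1) measurable_const
  have m3 := measurable_pos (f := fun s ↦ s ^ 2 / 2) (by fun_prop)
  let F : ℝ → ℝ → ℝ → ℝ≥0∞ := fun b a x ↦ ENNReal.ofReal (2 * a) *
    (pos (fun _ ↦ 1) (x - b) * ENNReal.ofReal (x * phi (x + 2 * a)))
  have mF : Measurable fun p : (ℝ × ℝ) × ℝ ↦ F p.1.1 p.1.2 p.2 := by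
    simp only [F]; fun_prop
  have h1 : ∀ b a, ENNReal.ofReal (2 * a) * ∫⁻ x in Ioi b, ENNReal.ofReal (x * phi (x + 2 * a)) =
      ∫⁻ x, F b a x := by
    intro b a
    rw [setLIntegral_congr Ioi_ae_eq_Ici, ← lintegral_indicator measurableSet_Ici,
      ← lintegral_const_mul _ ((by fun_prop : Measurable fun x ↦
        ENNReal.ofReal (x * phi (x + 2 * a))).indicator measurableSet_Ici)]
    refine lintegral_congr fun x ↦ ?_
    simp only [F]
    congr 1
    by_cases hx : b ≤ x
    · rw [indicator_of_mem (by exact hx), pos_of_nonneg _ (by linarith), ENNReal.ofReal_one,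
        one_mul]
    · rw [indicator_of_notMem (by exact hx), pos_of_neg _ (by linarith), zero_mul]
  -- Integrating out `b ∈ (0, x)` gives a factor `x`, and `2a · x · x = 4 · (x² / 2) · a`. The `4`
  -- is later absorbed by rescaling `a` to `2a`, once for the weight and once for the Jacobian.
  have h2 : ∀ a x, 0 < a → ∫⁻ b in Ioi 0, F b a x = 4 * (pos (fun s ↦ s ^ 2 / 2) x *
      pos (fun a ↦ a) a * ENNReal.ofReal (phi (x + 2 * a))) := by
    intro a x ha
    have h3 : ∫⁻ b in Ioi 0, pos (fun _ ↦ 1) (x - b) = ENNReal.ofReal x := by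
      have : ∀ b, pos (fun _ ↦ 1) (x - b) = (Iic x).indicator 1 b := fun b ↦ by
        by_cases hb : b ≤ x
        · rw [indicator_of_mem (by exact hb), pos_of_nonneg _ (by linarith)]; simp
        · rw [indicator_of_notMem (by exact hb), pos_of_neg _ (by linarith)]
      simp_rw [this]
      rw [lintegral_indicator_one measurableSet_Iic, Measure.restrict_apply measurableSet_Iic,
        inter_comm, Ioi_inter_Iic, Real.volume_Ioc, sub_zero]
    simp only [F]
    rw [lintegral_const_mul _ (by fun_prop), lintegral_mul_const _ (by fun_prop), h3]
    rcases lt_or_ge x 0 with hx | hx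
    · rw [ENNReal.ofReal_of_nonpos hx.le, pos_of_neg _ hx]
      simp
    · rw [pos_of_nonneg _ hx, pos_of_nonneg _ ha.le, show (4 : ℝ≥0∞) = ENNReal.ofReal 4 by simp,
        ← ENNReal.ofReal_mul hx, ← ENNReal.ofReal_mul (by positivity),
        ← ENNReal.ofReal_mul (by positivity), ← ENNReal.ofReal_mul (by positivity),
        ← ENNReal.ofReal_mul (by positivity)]
      congr 1
      ring
  let G : ℝ → ℝ → ℝ≥0∞ := fun x a ↦ pos (fun s ↦ s ^ 2 / 2) x *
      pos (fun a ↦ a) a * ENNReal.ofReal (phi (x + a))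
  have mG : Measurable fun p : ℝ × ℝ ↦ G p.1 p.2 := by simp only [G]; fun_prop
  have h4 : ∀ a x, pos (fun s ↦ s ^ 2 / 2) x * pos (fun a ↦ a) a *
      ENNReal.ofReal (phi (x + 2 * a)) = ENNReal.ofReal 2⁻¹ * G x (2 * a) := by
    intro a x
    simp only [G]
    rw [pos_id, pos_id, show a = 2⁻¹ * (2 * a) by ring, ENNReal.ofReal_mul (by positivity),
      show 2 * (2⁻¹ * (2 * a)) = 2 * a by ring]
    ring
  calc _ = ∫⁻ b in Ioi 0, ∫⁻ a in Ioi 0, ∫⁻ x, F b a x := by simp_rw [h1]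
    _ = ∫⁻ a in Ioi 0, ∫⁻ b in Ioi 0, ∫⁻ x, F b a x :=
      lintegral_lintegral_swap mF.lintegral_prod_right'.aemeasurable
    _ = ∫⁻ a in Ioi 0, ∫⁻ x, ∫⁻ b in Ioi 0, F b a x := by
      refine lintegral_congr fun a ↦ lintegral_lintegral_swap ?_
      exact (mF.comp (by fun_prop : Measurable fun p : ℝ × ℝ ↦ ((p.1, a), p.2))).aemeasurable
    _ = ∫⁻ a in Ioi 0, ∫⁻ x, 4 * (ENNReal.ofReal 2⁻¹ * G x (2 * a)) := by
      refine setLIntegral_congr_fun measurableSet_Ioi fun a ha ↦ lintegral_congr fun x ↦ ?_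
      rw [h2 a x ha, h4]
    _ = ∫⁻ a, ∫⁻ x, 4 * (ENNReal.ofReal 2⁻¹ * G x (2 * a)) := by
      refine setLIntegral_Ioi_eq fun a ha ↦ (lintegral_congr fun x ↦ ?_).trans lintegral_zero
      simp only [G, pos_id_of_nonpos (show 2 * a ≤ 0 by linarith), mul_zero, zero_mul]
    _ = ∫⁻ x, ∫⁻ a, 4 * (ENNReal.ofReal 2⁻¹ * G x (2 * a)) :=
      lintegral_lintegral_swap (by simp only [G]; fun_prop)
    _ = ∫⁻ x, 4 * (ENNReal.ofReal 2⁻¹ * (ENNReal.ofReal 2⁻¹ * ∫⁻ a, G x a)) := by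
      refine lintegral_congr fun x ↦ ?_
      rw [lintegral_const_mul _ (by simp only [G]; fun_prop),
        lintegral_const_mul _ (by simp only [G]; fun_prop),
        lintegral_comp_mul_left_pos two_pos (f := fun a ↦ G x a) (by simp only [G]; fun_prop)]
    _ = ∫⁻ x, ∫⁻ a, G x a := by
      refine lintegral_congr fun x ↦ ?_
      rw [← mul_assoc, ← mul_assoc, show (4 : ℝ≥0∞) = ENNReal.ofReal 4 by simp,
        ← ENNReal.ofReal_mul (by positivity), ← ENNReal.ofReal_mul (by positivity)]
      norm_num
    _ = _ := lintegral_pos_sq_mul_pos_id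

lemma lintegral_add_tsum (A : ℝ → ℝ → ℝ≥0∞) (F : ℕ → ℝ → ℝ → ℝ≥0∞)
    (hF : ∀ n, Measurable fun p : ℝ × ℝ ↦ F n p.1 p.2) :
    ∫⁻ b in Ioi 0, ∫⁻ a in Ioi 0, (A b a + ∑' n, F n b a) =
      (∫⁻ b in Ioi 0, ∫⁻ a in Ioi 0, A b a) + ∑' n, ∫⁻ b in Ioi 0, ∫⁻ a in Ioi 0, F n b a := by
  have m1 : ∀ n, Measurable fun b ↦ ∫⁻ a in Ioi 0, F n b a := fun n ↦ (hF n).lintegral_prod_right'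
  have m2 : ∀ n b, Measurable (F n b) := fun n b ↦
    (hF n).comp (by fun_prop : Measurable fun a : ℝ ↦ (b, a))
  have hin : ∀ b, ∫⁻ a in Ioi 0, (A b a + ∑' n, F n b a) =
      (∫⁻ a in Ioi 0, A b a) + ∑' n, ∫⁻ a in Ioi 0, F n b a := by
    intro b
    rw [lintegral_add_right _ (Measurable.tsum fun n ↦ m2 n b),
      lintegral_tsum fun n ↦ (m2 n b).aemeasurable]
  simp_rw [hin]
  rw [lintegral_add_right _ (Measurable.tsum m1),
    lintegral_tsum fun n ↦ (m1 n).aemeasurable]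

/-- The integral over both levels of the joint crossing formula. -/
theorem lintegral_crossing :
    ∫⁻ b in Ioi 0, ∫⁻ a in Ioi 0, ENNReal.ofReal (2 * a) *
      ((∫⁻ x in Ioi b, ENNReal.ofReal (x * phi (x + 2 * a))) +
        ∑' n : ℕ, ∫⁻ x in Ioc 0 b, ENNReal.ofReal (x * imageTerm (n + 1) a b x)) =
    ENNReal.ofReal (1 / 16) + ∑' n : ℕ, ENNReal.ofReal (imageCoeff (n + 1 : ℕ) / 8) := by
  have mT : ∀ n : ℕ, Measurable fun p : (ℝ × ℝ) × ℝ ↦ 2 * (weight p.1.1 p.1.2 p.2 *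
      ENNReal.ofReal (imageTerm (n + 1) p.1.2 p.1.1 p.2)) := fun n ↦ by
    have := measurable_weight
    unfold imageTerm
    fun_prop
  have h1 : ∀ n : ℕ, ∀ b a, ENNReal.ofReal (2 * a) *
      ∫⁻ x in Ioc 0 b, ENNReal.ofReal (x * imageTerm (n + 1) a b x) =
      ∫⁻ x, 2 * (weight b a x * ENNReal.ofReal (imageTerm (n + 1) a b x)) := by
    intro n b a
    have hm : Measurable fun x ↦ ENNReal.ofReal (x * imageTerm (n + 1) a b x) := by
      unfold imageTerm; fun_prop
    rw [← lintegral_indicator measurableSet_Ioc,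
      ← lintegral_const_mul _ (hm.indicator measurableSet_Ioc)]
    refine lintegral_congr fun x ↦ ?_
    rw [weight, pos_id, pos_id, ENNReal.ofReal_mul zero_le_two, ENNReal.ofReal_ofNat]
    by_cases hx : x ∈ Ioc 0 b
    · rw [indicator_of_mem hx, pos_of_nonneg _ (sub_nonneg.2 hx.2), ENNReal.ofReal_mul hx.1.le,
        ENNReal.ofReal_one]
      ring
    · rw [indicator_of_notMem hx]
      rw [mem_Ioc, not_and_or, not_lt, not_le] at hx
      rcases hx with hx | hx
      · simp [ENNReal.ofReal_of_nonpos hx]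
      · simp [pos_of_neg (fun _ ↦ 1) (show b - x < 0 by linarith)]
  simp_rw [mul_add, ← ENNReal.tsum_mul_left, h1]
  rw [lintegral_add_tsum _ _ fun n ↦ (mT n).lintegral_prod_right', lintegral_far_crossing]
  refine congrArg _ (tsum_congr fun n ↦ ?_)
  have h2 := lintegral_weight_imageTerm (k := n + 1) (by lia)
  have hpull : ∫⁻ b in Ioi 0, ∫⁻ a in Ioi 0,
      ∫⁻ x, 2 * (weight b a x * ENNReal.ofReal (imageTerm (n + 1) a b x)) =
      2 * ∫⁻ b in Ioi 0, ∫⁻ a in Ioi 0,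
      ∫⁻ x, weight b a x * ENNReal.ofReal (imageTerm (n + 1) a b x) := by
    simp_rw [lintegral_const_mul' _ _ ENNReal.ofNat_ne_top]
  rw [hpull, h2, show (2 : ℝ≥0∞) = ENNReal.ofReal 2 by simp, ← ENNReal.ofReal_mul zero_le_two]
  congr 1
  ring

end CrossingIntegral

/-! ### Summing the rational series, and numerical bounds. -/

section Series

lemma hasSum_zeta_three :
    HasSum (fun n : ℕ ↦ 1 / ((n : ℝ) + 1) ^ 3) (riemannZeta 3).re := by
  have hs : Summable fun n : ℕ ↦ 1 / (n : ℝ) ^ 3 := Real.summable_one_div_nat_pow.2 (by norm_num)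
  have h1 : (riemannZeta 3).re = ∑' n : ℕ, 1 / (n : ℝ) ^ 3 := by
    have h := zeta_nat_eq_tsum_of_gt_one (k := 3) (by norm_num)
    have h2 : riemannZeta 3 = ((∑' n : ℕ, 1 / (n : ℝ) ^ 3 : ℝ) : ℂ) := by
      push_cast
      exact_mod_cast h
    rw [h2, Complex.ofReal_re]
  have h3 := (hasSum_nat_add_iff' 1).2 hs.hasSum
  rw [← h1, Finset.sum_range_one] at h3
  norm_num at h3 ⊢
  exact h3

/-- Partial fractions with poles at `2k - 1`, `2k`, `2k + 1`, `2k + 2`: the cubes give `1 / (4 k³)`,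
the alternating reciprocals give harmonic numbers, and the rest telescopes. The induction only
verifies the result. -/
lemma sum_imageCoeff (n : ℕ) :
    ∑ k ∈ Finset.range n, imageCoeff (k + 1 : ℕ) =
      1 / 4 * ∑ k ∈ Finset.range n, 1 / ((k : ℝ) + 1) ^ 3
        - 8 * ((harmonic (2 * n) : ℝ) - harmonic n) +
      (1 - (1 / (2 * n + 1) : ℝ) ^ 2 - 1 / 2 * (1 / 4 - (1 / (2 * n + 2) : ℝ) ^ 2) +
        5 * (1 - 1 / (2 * n + 1)) - (1 / 2 - 1 / (2 * n + 2))) := by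
  induction n with
  | zero => norm_num
  | succ n ih =>
    rw [Finset.sum_range_succ, ih, Finset.sum_range_succ, show 2 * (n + 1) = 2 * n + 1 + 1 by ring,
      harmonic_succ, harmonic_succ, harmonic_succ]
    unfold imageCoeff
    push_cast
    have h1 : (2 * ((n : ℝ) + 1) - 1) ≠ 0 := by
      have : (0 : ℝ) ≤ n := n.cast_nonneg
      linarith
    have h2 : (2 * (n : ℝ) + 1) ≠ 0 := by positivity
    have h3 : (2 * ((n : ℝ) + 1) + 1) ≠ 0 := by positivity
    rw [show (2 * ((n : ℝ) + 1) - 1) = 2 * n + 1 by ring,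
      show (2 * ((n : ℝ) + 1) + 1) = 2 * n + 3 by ring,
      show (2 * ((n : ℝ) + 1) + 2) = 2 * (n + 2) by ring,
      show (2 * (n : ℝ) + 1 + 1) = 2 * (n + 1) by ring,
      show (2 * (n : ℝ) + 2) = 2 * (n + 1) by ring]
    have h4 : (2 * (n : ℝ) + 3) ≠ 0 := by positivity
    have h5 : ((n : ℝ) + 2) ≠ 0 := by positivity
    have h6 : ((n : ℝ) + 1) ≠ 0 := by positivity
    field_simp
    ring

/-- The Euler–Mascheroni constants cancel, leaving `log (2n) - log n`. -/
lemma tendsto_harmonic_two_mul_sub :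
    Tendsto (fun n : ℕ ↦ (harmonic (2 * n) : ℝ) - harmonic n) atTop (𝓝 (Real.log 2)) := by
  have h := Real.tendsto_harmonic_sub_log
  have h2 : Tendsto (fun n : ℕ ↦ 2 * n) atTop atTop :=
    tendsto_id.const_mul_atTop' two_pos
  have h3 := ((h.comp h2).sub h).add_const (Real.log 2)
  rw [sub_self, zero_add] at h3
  refine h3.congr' ?_
  filter_upwards [eventually_gt_atTop 0] with n hn
  have hn' : (n : ℝ) ≠ 0 := by exact_mod_cast hn.ne'
  simp only [Function.comp_apply]
  push_cast
  rw [Real.log_mul two_ne_zero hn']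
  ring

lemma imageCoeff_nonneg {k : ℝ} (hk : 1 ≤ k) : 0 ≤ imageCoeff k := by
  have h0 : 0 < 2 * k - 1 := by linarith
  have h1 : 1 / ((2 * k) ^ 2 * (2 * k + 1) ^ 2 * (2 * k + 2)) ≤
      1 / ((2 * k) ^ 3 * (2 * k - 1) ^ 2) := by
    apply one_div_le_one_div_of_le (by positivity)
    calc (2 * k) ^ 3 * (2 * k - 1) ^ 2 = (2 * k) ^ 2 * (2 * k - 1) ^ 2 * (2 * k) := by ring
      _ ≤ _ := by gcongr <;> linarith
  have h2 : 1 / ((2 * k + 2) ^ 2 * (2 * k + 1) ^ 2 * (2 * k)) ≤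
      1 / ((2 * k) ^ 3 * (2 * k + 1) ^ 2) := by
    apply one_div_le_one_div_of_le (by positivity)
    calc (2 * k) ^ 3 * (2 * k + 1) ^ 2 = (2 * k) ^ 2 * (2 * k + 1) ^ 2 * (2 * k) := by ring
      _ ≤ _ := by gcongr; linarith
  unfold imageCoeff
  linarith

lemma hasSum_imageCoeff : HasSum (fun n : ℕ ↦ imageCoeff (n + 1 : ℕ))
    ((riemannZeta 3).re / 4 - 8 * Real.log 2 + 43 / 8) := by
  rw [hasSum_iff_tendsto_nat_of_nonneg fun n ↦ imageCoeff_nonneg (by simp)]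
  simp_rw [sum_imageCoeff]
  have hn : Tendsto (fun n : ℕ ↦ 2 * (n : ℝ)) atTop atTop :=
    tendsto_natCast_atTop_atTop.const_mul_atTop two_pos
  have h1 : Tendsto (fun n : ℕ ↦ (1 / (2 * n + 1) : ℝ)) atTop (𝓝 0) := by
    simp_rw [one_div]
    exact tendsto_inv_atTop_zero.comp (tendsto_atTop_add_const_right _ _ hn)
  have h2 : Tendsto (fun n : ℕ ↦ (1 / (2 * n + 2) : ℝ)) atTop (𝓝 0) := by
    simp_rw [one_div]
    exact tendsto_inv_atTop_zero.comp (tendsto_atTop_add_const_right _ _ hn)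
  have h := ((hasSum_zeta_three.tendsto_sum_nat.const_mul (1 / 4)).sub
    (tendsto_harmonic_two_mul_sub.const_mul 8)).add
    ((((h1.pow 2).const_sub 1).sub (((h2.pow 2).const_sub (1 / 4)).const_mul (1 / 2))).add
      ((h1.const_sub 1).const_mul 5) |>.sub (h2.const_sub (1 / 2)))
  convert h using 2
  norm_num
  ring

/-- Partial sums are corrected by the tail estimate `1 / (2n² + 2n + c)`. With `m = n + 1`, the
correction drops in one step by `4m / (4m⁴ + 4(c - 1)m² + c²)`, to be compared with the new term `1
/ m³`. For `c = 1` the drop is smaller, so the corrected sums increase. For `c = 0.99` it is larger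
once `m² > 24.5`, so they decrease from `n = 4` on. -/
lemma zeta_three_bounds :
    1.202056890 < (riemannZeta 3).re ∧ (riemannZeta 3).re < 1.202057190 := by
  have hlim := hasSum_zeta_three.tendsto_sum_nat
  have hz : ∀ c : ℝ, Tendsto (fun n : ℕ ↦ 1 / (2 * (n : ℝ) ^ 2 + 2 * n + c)) atTop (𝓝 0) := by
    intro c
    simp_rw [one_div]
    refine tendsto_inv_atTop_zero.comp (tendsto_atTop_add_const_right _ _ ?_)
    have hn : Tendsto (fun n : ℕ ↦ (n : ℝ)) atTop atTop := tendsto_natCast_atTop_atTop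
    exact (((tendsto_pow_atTop two_ne_zero).comp hn).const_mul_atTop two_pos).atTop_add_atTop
      (hn.const_mul_atTop two_pos)
  have hl : ∀ c, Tendsto (fun n : ℕ ↦ ∑ k ∈ Finset.range n, 1 / ((k : ℝ) + 1) ^ 3 +
      1 / (2 * (n : ℝ) ^ 2 + 2 * n + c)) atTop (𝓝 (riemannZeta 3).re) := fun c ↦ by
    simpa using hlim.add (hz c)
  constructor
  · have hmono : Monotone (fun n : ℕ ↦ ∑ k ∈ Finset.range n, 1 / ((k : ℝ) + 1) ^ 3 +
        1 / (2 * (n : ℝ) ^ 2 + 2 * n + 1)) := by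
      refine monotone_nat_of_le_succ fun n ↦ ?_
      rw [Finset.sum_range_succ, add_assoc (Finset.sum _ _)]
      refine (add_le_add_iff_left _).2 ?_
      have hn : (0 : ℝ) ≤ n := n.cast_nonneg
      push_cast
      rw [div_add_div _ _ (by positivity) (by positivity), div_le_div_iff₀ (by positivity)
        (by positivity)]
      nlinarith [pow_nonneg hn 2, pow_nonneg hn 3, pow_nonneg hn 4]
    have := hmono.ge_of_tendsto (hl 1) 12
    refine lt_of_lt_of_le ?_ this
    norm_num [Finset.sum_range_succ]
  · have hanti : Antitone (fun m : ℕ ↦ ∑ k ∈ Finset.range (m + 4), 1 / ((k : ℝ) + 1) ^ 3 +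
        1 / (2 * ((m + 4 : ℕ) : ℝ) ^ 2 + 2 * (m + 4 : ℕ) + 0.99)) := by
      refine antitone_nat_of_succ_le fun m ↦ ?_
      rw [show m + 1 + 4 = m + 4 + 1 by ring, Finset.sum_range_succ, add_assoc (Finset.sum _ _)]
      refine (add_le_add_iff_left _).2 ?_
      have hn : (0 : ℝ) ≤ m := m.cast_nonneg
      push_cast
      rw [div_add_div _ _ (by positivity) (by positivity), div_le_div_iff₀ (by positivity)
        (by positivity)]
      nlinarith [pow_nonneg hn 2, pow_nonneg hn 3, pow_nonneg hn 4]
    -- Because of the shift by `4`, this evaluates the corrected sum at `n = 16`.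
    have := hanti.le_of_tendsto ((hl 0.99).comp (tendsto_add_atTop_nat 4)) 12
    refine lt_of_le_of_lt this ?_
    norm_num [Finset.sum_range_succ]

lemma abs_expectation_value_sub_lt :
    |(riemannZeta 3).re / 16 - 2 * Real.log 2 + 47 / 32 - 0.1575842| < 5e-8 := by
  have h1 := zeta_three_bounds
  have h2 := Real.log_two_gt_d9
  have h3 := Real.log_two_lt_d9
  rw [abs_lt]
  constructor <;> linarith [h1.1, h1.2]

/-- The total mass of the joint crossing formula. -/
lemma tsum_imageCoeff :
    ENNReal.ofReal (1 / 16) + ∑' n : ℕ, ENNReal.ofReal (imageCoeff (n + 1 : ℕ) / 8) =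
      ENNReal.ofReal (((riemannZeta 3).re / 16 - 2 * Real.log 2 + 47 / 32) / 2) := by
  have h := hasSum_imageCoeff.div_const 8
  have hnn : ∀ n : ℕ, 0 ≤ imageCoeff (n + 1 : ℕ) / 8 := fun n ↦
    div_nonneg (imageCoeff_nonneg (by simp)) (by norm_num)
  rw [← ENNReal.ofReal_tsum_of_nonneg hnn h.summable, ← ENNReal.ofReal_add (by norm_num)
    (tsum_nonneg hnn), h.tsum_eq]
  congr 1
  ring

end Series

/-! ### Extrema of continuous paths, and the split by the sign of the increment. -/

section Paths

lemma isLUB_path {w : ℝ≥0 → ℝ} (hw : Continuous w) :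
    IsLUB (w '' Icc 0 1) (sSup (w '' Icc 0 1)) :=
  (isCompact_Icc.image hw).isLUB_sSup ((nonempty_Icc.2 zero_le_one).image w)

lemma isGLB_path {w : ℝ≥0 → ℝ} (hw : Continuous w) :
    IsGLB (w '' Icc 0 1) (sInf (w '' Icc 0 1)) :=
  (isCompact_Icc.image hw).isGLB_sInf ((nonempty_Icc.2 zero_le_one).image w)

lemma lt_sSup_path_iff {w : ℝ≥0 → ℝ} (hw : Continuous w) {b : ℝ} :
    b < sSup (w '' Icc 0 1) ↔ ∃ t ≤ 1, b < w t := by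
  rw [lt_isLUB_iff (isLUB_path hw)]
  simp

lemma sInf_path_lt_iff {w : ℝ≥0 → ℝ} (hw : Continuous w) {b : ℝ} :
    sInf (w '' Icc 0 1) < b ↔ ∃ t ≤ 1, w t < b := by
  rw [isGLB_lt_iff (isGLB_path hw)]
  simp

lemma zero_le_sSup_path {w : ℝ≥0 → ℝ} (hw : Continuous w) (h0 : w 0 = 0) :
    0 ≤ sSup (w '' Icc 0 1) :=
  (isLUB_path hw).1 ⟨0, by simp, h0⟩

lemma sInf_path_le_zero {w : ℝ≥0 → ℝ} (hw : Continuous w) (h0 : w 0 = 0) :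
    sInf (w '' Icc 0 1) ≤ 0 :=
  (isGLB_path hw).1 ⟨0, by simp, h0⟩

/-- `C H L ^ 2` on the paths with positive increment. -/
noncomputable def upProduct (w : ℝ≥0 → ℝ) : ℝ :=
  max (w 1) 0 * sSup (w '' Icc 0 1) * sInf (w '' Icc 0 1) ^ 2

/-- The factor `max (w 1) 0` kills one summand, or both when `w 1 = 0`; in that case `C w = 0` as
well. -/
lemma product_eq_upProduct_add {w : ℝ≥0 → ℝ} (h0 : w 0 = 0) :
    C w * H w * L w ^ 2 = upProduct w + upProduct (-w) := by
  have hflip : ∀ t, flip w t = w t * Real.sign (w 1) := fun t ↦ by simp [flip, h0]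
  rcases lt_trichotomy (w 1) 0 with h | h | h
  · have : flip w = -w := by
      ext t; rw [hflip, Real.sign_of_neg h]; simp
    simp [C, H, L, spreadClose, spreadHigh, spreadLow, upProduct, this, h0, h.le]
  · have : C w = 0 := by simp [C, spreadClose, hflip, h, h0]
    simp [upProduct, this, h]
  · have : flip w = w := by
      ext t; rw [hflip, Real.sign_of_pos h]; simp
    simp [C, H, L, spreadClose, spreadHigh, spreadLow, upProduct, this, h0, h.le]

end Paths

/-! ### Layer-cake formula and the expectation. -/

section Expectation

variable {Ω : Type*} [MeasurableSpace Ω] {P : Measure Ω} {B : ℝ≥0 → Ω → ℝ}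

lemma aemeasurable_sSup_path (hB : IsBrownianReal B P) :
    AEMeasurable (fun ω ↦ sSup ((B · ω) '' Icc 0 1)) P := by
  refine AEMeasurable.isLUB (f := fun (i : Σ n : ℕ, Fin (n + 2)) ↦ B (i.2 / (i.1 + 1)))
    (fun i ↦ hB.aemeasurable _) ?_
  filter_upwards [hB.cont] with ω hc
  refine ⟨?_, fun c hcc ↦ le_of_not_gt fun hlt ↦ ?_⟩
  · rintro _ ⟨i, rfl⟩
    exact (isLUB_path hc).1 ⟨_, ⟨zero_le, grid_le_one i.2.2⟩, rfl⟩
  · obtain ⟨t, ht, htc⟩ := (lt_sSup_path_iff hc).1 hlt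
    obtain ⟨n, k, hk, hh⟩ := (eventually_exists_firstHit hc isOpen_Ioi ht htc).exists
    exact absurd (hcc ⟨⟨n, k, hk⟩, rfl⟩) (not_le.2 hh.1)

lemma aemeasurable_sInf_path (hB : IsBrownianReal B P) :
    AEMeasurable (fun ω ↦ sInf ((B · ω) '' Icc 0 1)) P := by
  refine AEMeasurable.isGLB (f := fun (i : Σ n : ℕ, Fin (n + 2)) ↦ B (i.2 / (i.1 + 1)))
    (fun i ↦ hB.aemeasurable _) ?_
  filter_upwards [hB.cont] with ω hc
  refine ⟨?_, fun c hcc ↦ le_of_not_gt fun hlt ↦ ?_⟩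
  · rintro _ ⟨i, rfl⟩
    exact (isGLB_path hc).1 ⟨_, ⟨zero_le, grid_le_one i.2.2⟩, rfl⟩
  · obtain ⟨t, ht, htc⟩ := (sInf_path_lt_iff hc).1 hlt
    obtain ⟨n, k, hk, hh⟩ := (eventually_exists_firstHit hc isOpen_Iio ht htc).exists
    exact absurd (hcc ⟨⟨n, k, hk⟩, rfl⟩) (not_le.2 hh.1)

/-- The layer-cake formula is applied twice, to `Y` and to `Z² = ∫₀^Z 2a da`; each time the
remaining factors are absorbed into the measure as a density. -/
lemma lintegral_mul_ofReal_mul_sq [SFinite P] {X : Ω → ℝ≥0∞} {Y Z : Ω → ℝ} (hX : AEMeasurable X P)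
    (hY : AEMeasurable Y P) (hZ : AEMeasurable Z P) (hY0 : 0 ≤ᵐ[P] Y) (hZ0 : 0 ≤ᵐ[P] Z) :
    ∫⁻ ω, X ω * ENNReal.ofReal (Z ω ^ 2) * ENNReal.ofReal (Y ω) ∂P =
      ∫⁻ b in Ioi 0, ∫⁻ a in Ioi 0, ENNReal.ofReal (2 * a) *
        ∫⁻ ω in {ω | b < Y ω} ∩ {ω | a < Z ω}, X ω ∂P := by
  have hXZ : AEMeasurable (fun ω ↦ X ω * ENNReal.ofReal (Z ω ^ 2)) P :=
    hX.mul (hZ.pow_const 2).ennreal_ofReal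
  have hSY : ∀ b, NullMeasurableSet {ω | b < Y ω} P := fun b ↦
    hY.nullMeasurableSet_preimage measurableSet_Ioi
  have hSZ : ∀ a, NullMeasurableSet {ω | a < Z ω} P := fun a ↦
    hZ.nullMeasurableSet_preimage measurableSet_Ioi
  have h1 := lintegral_eq_lintegral_meas_lt
    (P.withDensity fun ω ↦ X ω * ENNReal.ofReal (Z ω ^ 2))
    ((withDensity_absolutelyContinuous _ _).ae_le hY0)
    (hY.mono_ac (withDensity_absolutelyContinuous _ _))
  rw [lintegral_withDensity_eq_lintegral_mul₀ hXZ hY.ennreal_ofReal] at h1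
  simp only [Pi.mul_apply] at h1
  rw [h1]
  refine lintegral_congr fun b ↦ ?_
  rw [withDensity_apply₀ _ (hSY b)]
  let ν := (P.restrict {ω | b < Y ω}).withDensity X
  have hac : ν ≪ P := (withDensity_absolutelyContinuous _ _).trans
    Measure.absolutelyContinuous_restrict
  have h2 := lintegral_comp_eq_lintegral_meas_lt_mul ν (g := fun t ↦ 2 * t)
    (hac.ae_le hZ0) (hZ.mono_ac hac)
    (fun t _ ↦ (by fun_prop : Continuous fun t : ℝ ↦ 2 * t).intervalIntegrable _ _)
    (by filter_upwards [ae_restrict_mem measurableSet_Ioi] with t ht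
        exact mul_nonneg zero_le_two (le_of_lt ht))
  have h3 : ∀ z : ℝ, ∫ t in 0..z, 2 * t = z ^ 2 := fun z ↦ by
    rw [intervalIntegral.integral_const_mul, integral_id]; ring
  simp_rw [h3] at h2
  rw [lintegral_withDensity_eq_lintegral_mul₀ hX.restrict (hZ.pow_const 2).ennreal_ofReal.restrict]
    at h2
  simp only [Pi.mul_apply] at h2
  rw [h2]
  refine lintegral_congr fun a ↦ ?_
  rw [mul_comm, withDensity_apply₀ _ ((hSZ a).mono_ac Measure.absolutelyContinuous_restrict),
    Measure.restrict_restrict₀ ((hSZ a).mono_ac Measure.absolutelyContinuous_restrict), inter_comm]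

lemma lintegral_upProduct (hB : IsBrownianReal B P) :
    ∫⁻ ω, ENNReal.ofReal (upProduct (B · ω)) ∂P =
      ENNReal.ofReal (((riemannZeta 3).re / 16 - 2 * Real.log 2 + 47 / 32) / 2) := by
  have hP : IsProbabilityMeasure P := hB.isGaussianProcess.isProbabilityMeasure
  have hlaw : HasLaw (B 1) (gaussianReal 0 1) P := hB.hasLaw_eval 1
  have hint : Integrable (fun ω ↦ max (B 1 ω) 0) P := by
    have hh := integrable_max_gaussian
    rw [← hlaw.map_eq] at hh
    exact hh.comp_aemeasurable hlaw.aemeasurable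
  have hY0 : 0 ≤ᵐ[P] fun ω ↦ sSup ((B · ω) '' Icc 0 1) := by
    filter_upwards [hB.cont, hB.eval_zero_ae_eq_zero] with ω hc h0
    exact zero_le_sSup_path hc h0
  have hZ0 : 0 ≤ᵐ[P] fun ω ↦ -sInf ((B · ω) '' Icc 0 1) := by
    filter_upwards [hB.cont, hB.eval_zero_ae_eq_zero] with ω hc h0
    exact neg_nonneg.2 (sInf_path_le_zero hc h0)
  have hlayer := lintegral_mul_ofReal_mul_sq hint.aemeasurable.ennreal_ofReal
    (aemeasurable_sSup_path hB) (aemeasurable_sInf_path hB).neg hY0 hZ0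
  rw [← tsum_imageCoeff, ← lintegral_crossing]
  calc
    _ = ∫⁻ ω, ENNReal.ofReal (max (B 1 ω) 0) *
        ENNReal.ofReal ((-sInf ((B · ω) '' Icc 0 1)) ^ 2) *
        ENNReal.ofReal (sSup ((B · ω) '' Icc 0 1)) ∂P := by
      refine lintegral_congr_ae ?_
      filter_upwards [hY0] with ω hω
      rw [← ENNReal.ofReal_mul (le_max_right _ _), ← ENNReal.ofReal_mul (by positivity)]
      unfold upProduct
      ring_nf
    _ = _ := hlayer
    _ = _ := by
      refine setLIntegral_congr_fun measurableSet_Ioi fun b hb ↦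
        setLIntegral_congr_fun measurableSet_Ioi fun a ha ↦ ?_
      rw [← ofReal_crossing ha hb, ← setIntegral_enter_inter hB ha hb,
        ofReal_integral_eq_lintegral_ofReal hint.integrableOn
          (ae_of_all _ fun ω ↦ le_max_right _ _)]
      congr 1
      refine setLIntegral_congr ?_
      filter_upwards [hB.cont] with ω hc
      refine propext (and_congr (lt_sSup_path_iff hc) ?_)
      exact lt_neg.trans (sInf_path_lt_iff hc)

lemma integral_upProduct (hB : IsBrownianReal B P) :
    Integrable (fun ω ↦ upProduct (B · ω)) P ∧ ∫ ω, upProduct (B · ω) ∂P =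
      ((riemannZeta 3).re / 16 - 2 * Real.log 2 + 47 / 32) / 2 := by
  have hlint := lintegral_upProduct hB
  have hnn : 0 ≤ᵐ[P] fun ω ↦ upProduct (B · ω) := by
    filter_upwards [hB.cont, hB.eval_zero_ae_eq_zero] with ω hc h0
    have := zero_le_sSup_path hc h0
    simp only [Pi.zero_apply, upProduct]
    positivity
  have hm : AEStronglyMeasurable (fun ω ↦ upProduct (B · ω)) P :=
    ((((hB.aemeasurable 1).max aemeasurable_const).mul (aemeasurable_sSup_path hB)).mul
      ((aemeasurable_sInf_path hB).pow_const 2)).aestronglyMeasurable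
  refine ⟨⟨hm, (hasFiniteIntegral_iff_ofReal hnn).2 (hlint ▸ ENNReal.ofReal_lt_top)⟩, ?_⟩
  rw [integral_eq_lintegral_of_nonneg_ae hnn hm, hlint, ENNReal.toReal_ofReal]
  -- `ENNReal.toReal_ofReal` needs the closed form to be nonnegative, which the decimal estimate
  -- shows.
  have := (abs_lt.1 abs_expectation_value_sub_lt).1
  linarith

end Expectation

end FlippedPath

theorem mainTheorem2 {Ω : Type*} [MeasurableSpace Ω] (P : Measure Ω)
    (B : ℝ≥0 → Ω → ℝ) (hB : IsBrownianReal B P) :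
    Integrable (fun ω => FlippedPath.C (B · ω) * FlippedPath.H (B · ω)
        * FlippedPath.L (B · ω) ^ 2) P ∧
    ∫ ω, FlippedPath.C (B · ω) * FlippedPath.H (B · ω) * FlippedPath.L (B · ω) ^ 2 ∂P
      = (riemannZeta 3).re / 16 - 2 * Real.log 2 + 47 / 32 ∧
    |(riemannZeta 3).re / 16 - 2 * Real.log 2 + 47 / 32 - 0.1575842| < 5e-8 := by
  obtain ⟨hi, hv⟩ := FlippedPath.integral_upProduct hB
  -- Paths with negative increment are handled by `-B`, also a Brownian motion, so both halves have
  -- the same mean.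
  obtain ⟨hi', hv'⟩ := FlippedPath.integral_upProduct hB.neg
  have hae : (fun ω => FlippedPath.C (B · ω) * FlippedPath.H (B · ω)
      * FlippedPath.L (B · ω) ^ 2) =ᵐ[P]
      fun ω ↦ FlippedPath.upProduct (B · ω) + FlippedPath.upProduct ((-B) · ω) := by
    filter_upwards [hB.eval_zero_ae_eq_zero] with ω h0
    exact FlippedPath.product_eq_upProduct_add h0
  refine ⟨(hi.add hi').congr hae.symm, ?_, FlippedPath.abs_expectation_value_sub_lt⟩
  rw [integral_congr_ae hae, integral_add hi hi', hv, hv']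
  ring
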